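/- Let $n\ge 1$ and let $V\in\mathbb{C}^{2^n\times 2^n}$ be unitary. Suppose there is $\alpha\in\mathbb{C}$, $\alpha\neq 0$, such that $|\alpha|^2\in\mathbb{Z}$ and all entries of $\alpha V$ lie in the ring $\mathbb{Z}[i,\tfrac{1}{\sqrt2}]$. Then there is a repeat-until-success (RUS) circuit over the Clifford+$T$ gate set that implements $V$ on at most $n+2$ qubits, with all ancilla qubits initialized to $|0\rangle$, and that applies the identity $\mathbb{1}_{2^n}$ to the target qubits whenever it fails. Here an RUS circuit on $n+m$ qubits ($n$ target qubits and $m$ ancillas, so $m\le 2$ above) consists of a circuit of gates $H=\frac1{\sqrt2}\begin{pmatrix}1&1\\1&-1\end{pmatrix}$, $T=\mathrm{diag}(1,e^{i\pi/4})$ and $\mathrm{CNOT}$ acting on these qubits, with unitary $U$, together with an outcome $s_0\in\{0,1\}^m$ of the computational-basis measurement of the ancillas that is labelled "success"; every other outcome is a failure. For $s\in\{0,1\}^m$ let $A_s=(\mathbb{1}\otimes\langle s|)\,U\,(\mathbb{1}\otimes|0\cdots0\rangle)$ be the operator applied (without normalization) to the target qubits at outcome $s$. The circuit implements $V$, and applies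 the identity on failure, if there are $p_s\in[0,1]$ with $p_{s_0}>0$ and unit complex numbers $\theta_s$ such that $A_{s_0}=\sqrt{p_{s_0}}\,\theta_{s_0}V$ and $A_s=\sqrt{p_s}\,\theta_s\mathbb{1}_{2^n}$ for all $s\ne s_0$. That is, on every input state, outcome $s$ has probability $p_s$, and it applies $V$ on success and the identity on failure, up to a global phase; after a failure the round can simply be repeated. -/

import Mathlib

/-- The ring `ℤ[i, 1/√2]`, as a subring of `ℂ`. -/
noncomputable def ringZISqrt : Subalgebra ℤ ℂ :=
  Algebra.adjoin ℤ {Complex.I, 1 / (Real.sqrt 2 : ℂ)}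

/-- The computational basis of a register whose qubits are labelled by `ι`: bit strings. -/
abbrev Bits (ι : Type) : Type := ι → Fin 2

/-- Operators on the register with qubits `ι`, as matrices in the computational basis. -/
abbrev QOp (ι : Type) : Type := Matrix (Bits ι) (Bits ι) ℂ

/-- The Hadamard gate `H`. -/
noncomputable def hadamardMat : Matrix (Fin 2) (Fin 2) ℂ :=
  (1 / (Real.sqrt 2 : ℂ)) • !![1, 1; 1, -1]

/-- The gate `T = diag(1, ω)` with `ω = exp(iπ/4)`. -/
noncomputable def tMat : Matrix (Fin 2) (Fin 2) ℂ :=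
  !![1, 0; 0, Complex.exp (Complex.I * Real.pi / 4)]

/-- The operator that acts as `g` on qubit `i` and as the identity on all other qubits. -/
def onQubit {ι : Type} [Fintype ι] [DecidableEq ι] (i : ι) (g : Matrix (Fin 2) (Fin 2) ℂ) :
    QOp ι :=
  fun x y => if ∀ j, j ≠ i → x j = y j then g (x i) (y i) else 0

/-- The controlled NOT: the basis state `y` goes to the one whose bit `t` is `y t ⊕ y c`
(addition in `Fin 2` is modulo 2). -/
def cnotOp {ι : Type} [Fintype ι] [DecidableEq ι] (c t : ι) : QOp ι :=
  fun x y => if x = Function.update y t (y t + y c) then 1 else 0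

/-- The generators of the Clifford+T gate set, placed on qubits of the register `ι`. -/
inductive CliffordTGate (ι : Type) : Type
  | H (i : ι) : CliffordTGate ι
  | T (i : ι) : CliffordTGate ι
  | CNOT (control target : ι) (ne : control ≠ target) : CliffordTGate ι

/-- The unitary of a gate. -/
noncomputable def CliffordTGate.op {ι : Type} [Fintype ι] [DecidableEq ι] :
    CliffordTGate ι → QOp ι
  | .H i => onQubit i hadamardMat
  | .T i => onQubit i tMat
  | .CNOT c t _ => cnotOp c t

/-- The unitary of a circuit, given as the list of its gates; the head is applied first. -/
noncomputable def circuitOp {ι : Type} [Fintype ι] [DecidableEq ι] :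
    List (CliffordTGate ι) → QOp ι
  | [] => 1
  | g :: gs => circuitOp gs * g.op

/-- A repeat-until-success circuit over Clifford+T with `n` target qubits and `m` ancilla qubits:
a Clifford+T circuit on the `n + m` qubits, and the outcome of the computational-basis measurement
of the ancillas that is labelled "success". The ancillas start in the state `|0…0⟩`. -/
structure RUSCircuit (n m : ℕ) where
  design : List (CliffordTGate (Fin n ⊕ Fin m))
  success : Bits (Fin m)

/-- The measurement operator `(1 ⊗ ⟨s|) U (1 ⊗ |0…0⟩)` of one round: if the target qubits are in the
normalized state `ψ`, then the ancilla measurement has outcome `s` with probability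
`‖outcomeOp s ψ‖²`, and it leaves the target qubits in the direction of `outcomeOp s ψ`. -/
noncomputable def RUSCircuit.outcomeOp {n m : ℕ} (R : RUSCircuit n m) (s : Bits (Fin m)) :
    QOp (Fin n) :=
  fun x y => circuitOp R.design (Sum.elim x s) (Sum.elim y (fun _ => 0))

/-- The measurement operator `A` occurs with probability `p` on every normalized input state, and
in that case it applies `V` up to a global phase. -/
def AppliesWithProb {n : ℕ} (A V : QOp (Fin n)) (p : ℝ) : Prop :=
  0 ≤ p ∧ p ≤ 1 ∧ ∃ phase : ℂ, ‖phase‖ = 1 ∧ A = ((Real.sqrt p : ℂ) * phase) • V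

/-- The circuit `R` is a repeat-until-success circuit that implements `V`, with the operation `W s`
on the target qubits at the failure outcome `s`: the success outcome has a positive probability
and applies the unitary `V`, and each failure outcome `s` applies the unitary `W s`, up to global
phases and with probabilities independent of the input. Failures are undone by `(W s)⁻¹` and
the round is repeated. A failure outcome may have probability zero. -/
def RUSCircuit.Implements {n m : ℕ} (R : RUSCircuit n m) (V : QOp (Fin n))
    (W : Bits (Fin m) → QOp (Fin n)) : Prop :=
  V ∈ Matrix.unitaryGroup (Bits (Fin n)) ℂ ∧
  (∃ p : ℝ, 0 < p ∧ AppliesWithProb (R.outcomeOp R.success) V p) ∧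
  ∀ s, s ≠ R.success →
    W s ∈ Matrix.unitaryGroup (Bits (Fin n)) ℂ ∧ ∃ q : ℝ, AppliesWithProb (R.outcomeOp s) (W s) q

/-!
Let `M = αV` and `k = |α|²`, so that `M†M = k`. By Lagrange's four-square theorem
`4^k - k = |z|² + |w|²` with Gaussian integers `z`, `w` (`exists_gaussian_completion`). Hence the
block column `(M, z, w, 0) / 2^k` is an isometry with entries in `ℤ[i, 1/√2]`. A circuit on `n + 2`
qubits whose unitary has this first block column applies `M / 2^k`, a multiple of `V`, at outcome
`00`, and multiples of the identity at the other outcomes. It remains to find a circuit for the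
isometry that uses no further ancilla.

The circuit comes from a column-by-column reduction (`exists_circuit_columns`), in the manner of
the exact synthesis of Giles and Selinger, with the prime `δ = 1 - ω` of `ℤ[ω]`, where `δ²` is `√2`
up to a unit. In a unit vector over `ℤ[ω]` with denominator `δ^(K+1)` the number of numerators
prime to `δ` is even (`even_card_odd_numerators`), and up to a power of `ω` any two of them agree
modulo `δ³`. So a relative phase and a rotation by `π/4` make both divisible by `δ`
(`exists_pair_step`); when all are, the denominator drops. With denominator `1` only a power of `ω`
times a basis vector is left.

Only two-level operators of determinant one are used: the rotation by `π/4` and `diag(ω, ω⁻¹)`. The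
phase that should act on a single level is compensated on a third level that does not matter yet;
there is always one, because the isometry fills only a quarter of the columns. These operators need
no ancilla. The commutator of an `iX` with controls `A` and a `TXT⁻¹` with control `b` is an `iZ`
with controls `A ∪ {b}`, hence an `iX` with any controls is available by induction
(`controlled_iX_mem`). Its commutator with an uncontrolled `T` is a controlled `diag(ω, ω⁻¹)`, and
this is conjugate to the rotation by uncontrolled Clifford gates. Conjugation by right-angle
rotations then carries two-level operators from adjacent basis states to arbitrary pairs
(`levelsLinked`).
-/

open scoped Matrix

/-! ### Arithmetic of `ℤ[ω]` modulo powers of `1 - ω` -/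

/-- The primitive eighth root of unity `ω = exp(iπ/4)`. -/
noncomputable def omega : ℂ := Complex.exp (Complex.I * Real.pi / 4)

theorem omega_eq : omega = (Real.sqrt 2 / 2 : ℝ) + (Real.sqrt 2 / 2 : ℝ) * Complex.I := by
  have h : Complex.I * Real.pi / 4 = ((Real.pi / 4 : ℝ) : ℂ) * Complex.I := by
    push_cast; ring
  rw [omega, h, Complex.exp_mul_I, ← Complex.ofReal_cos, ← Complex.ofReal_sin,
    Real.cos_pi_div_four, Real.sin_pi_div_four]

theorem ofReal_sqrt_two_sq : (Real.sqrt 2 : ℂ) ^ 2 = 2 := by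
  rw [← Complex.ofReal_pow, Real.sq_sqrt (by norm_num)]; norm_num

theorem ofReal_sqrt_two_ne_zero : (Real.sqrt 2 : ℂ) ≠ 0 := by
  intro h
  have := ofReal_sqrt_two_sq
  rw [h] at this
  norm_num at this

theorem omega_sq : omega ^ 2 = Complex.I := by
  rw [omega_eq]
  push_cast
  linear_combination (Complex.I / 2) * ofReal_sqrt_two_sq
    + ((Real.sqrt 2 : ℂ) ^ 2 / 4) * Complex.I_sq

theorem omega_pow_four : omega ^ 4 = -1 := by
  rw [show omega ^ 4 = (omega ^ 2) ^ 2 by ring, omega_sq, Complex.I_sq]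

theorem omega_pow_eight : omega ^ 8 = 1 := by
  linear_combination (omega ^ 4 - 1) * omega_pow_four

theorem omega_ne_zero : omega ≠ 0 := Complex.exp_ne_zero _

theorem norm_omega : ‖omega‖ = 1 := by
  have h : Complex.I * Real.pi / 4 = ((Real.pi / 4 : ℝ) : ℂ) * Complex.I := by
    push_cast; ring
  rw [omega, h, Complex.norm_exp_ofReal_mul_I]

theorem star_omega : star omega = omega ^ 7 := by
  have h : omega * star omega = 1 := by
    rw [Complex.star_def, Complex.mul_conj, Complex.normSq_eq_norm_sq, norm_omega]
    norm_num
  linear_combination omega ^ 7 * h - star omega * omega_pow_eight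

theorem ofReal_sqrt_two_eq : (Real.sqrt 2 : ℂ) = omega - omega ^ 3 := by
  rw [show omega ^ 3 = omega ^ 2 * omega by ring, omega_sq, omega_eq]
  push_cast
  linear_combination (Real.sqrt 2 / 2 : ℂ) * Complex.I_sq

/-- The prime element `δ = 1 - ω` of `ℤ[ω]`; `δ²` is `√2` up to a unit. -/
noncomputable def delta : ℂ := 1 - omega

/-- The ring `ℤ[ω]`, as a subring of `ℂ`. -/
def zOmega : Subring ℂ where
  carrier := {x | ∃ a b c d : ℤ, x = a + b * omega + c * omega ^ 2 + d * omega ^ 3}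
  mul_mem' := by
    rintro _ _ ⟨a, b, c, d, rfl⟩ ⟨a', b', c', d', rfl⟩
    refine ⟨a * a' - b * d' - c * c' - d * b', a * b' + b * a' - c * d' - d * c',
      a * c' + b * b' + c * a' - d * d', a * d' + b * c' + c * b' + d * a', ?_⟩
    push_cast
    linear_combination ((b * d' + c * c' + d * b') + (c * d' + d * c') * omega
      + d * d' * omega ^ 2) * omega_pow_four
  one_mem' := ⟨1, 0, 0, 0, by simp⟩
  add_mem' := by
    rintro _ _ ⟨a, b, c, d, rfl⟩ ⟨a', b', c', d', rfl⟩
    exact ⟨a + a', b + b', c + c', d + d', by push_cast; ring⟩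
  zero_mem' := ⟨0, 0, 0, 0, by simp⟩
  neg_mem' := by
    rintro _ ⟨a, b, c, d, rfl⟩
    exact ⟨-a, -b, -c, -d, by push_cast; ring⟩

theorem omega_mem : omega ∈ zOmega := ⟨0, 1, 0, 0, by simp⟩

theorem delta_mem : delta ∈ zOmega := sub_mem (one_mem _) omega_mem

/-- Coordinates with respect to `1, √2` are unique, as `√2` is irrational. -/
theorem sqrt_two_coords_unique {a b c d : ℤ}
    (h : (a : ℝ) + b * Real.sqrt 2 = c + d * Real.sqrt 2) : a = c ∧ b = d := by
  have hbd : b = d := by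
    by_contra hne
    refine irrational_sqrt_two ⟨((c - a : ℤ) : ℚ) / ((b - d : ℤ) : ℚ), ?_⟩
    have : ((b - d : ℤ) : ℝ) ≠ 0 := by exact_mod_cast sub_ne_zero.mpr hne
    push_cast at this ⊢
    rw [div_eq_iff this]
    linarith
  subst hbd
  exact ⟨by exact_mod_cast add_right_cancel h, rfl⟩

theorem norm_sq_zOmega (a b c d : ℤ) :
    ‖(a + b * omega + c * omega ^ 2 + d * omega ^ 3 : ℂ)‖ ^ 2
      = ((a ^ 2 + b ^ 2 + c ^ 2 + d ^ 2 : ℤ) : ℝ)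
        + ((a * b - a * d + b * c + c * d : ℤ) : ℝ) * Real.sqrt 2 := by
  have h : (a + b * omega + c * omega ^ 2 + d * omega ^ 3 : ℂ)
      = ((a + (b - d) * (Real.sqrt 2 / 2) : ℝ) : ℂ)
        + ((c + (b + d) * (Real.sqrt 2 / 2) : ℝ) : ℂ) * Complex.I := by
    rw [show omega ^ 3 = omega ^ 2 * omega by ring, omega_sq, omega_eq]
    push_cast
    linear_combination (d * Real.sqrt 2 / 2 : ℂ) * Complex.I_sq
  rw [h, ← Complex.normSq_eq_norm_sq, Complex.normSq_add_mul_I]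
  have h2 : Real.sqrt 2 ^ 2 = 2 := Real.sq_sqrt (by norm_num)
  push_cast
  linear_combination ((b - d) ^ 2 / 4 + (b + d) ^ 2 / 4 : ℝ) * h2

theorem norm_delta_sq : ‖delta‖ ^ 2 = 2 - Real.sqrt 2 := by
  have h := norm_sq_zOmega 1 (-1) 0 0
  have e : ((1 : ℤ) + ((-1 : ℤ) : ℂ) * omega + ((0 : ℤ) : ℂ) * omega ^ 2
    + ((0 : ℤ) : ℂ) * omega ^ 3 : ℂ) = delta := by rw [delta]; push_cast; ring
  rw [e] at h
  rw [h]; push_cast; ring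

theorem delta_ne_zero : delta ≠ 0 := by
  intro h
  have := norm_delta_sq
  rw [h] at this
  have h2 := Real.sqrt_two_lt_three_halves
  norm_num at this
  linarith

theorem two_eq_delta_sq_mul : (2 : ℂ) = delta ^ 2 * (omega ^ 2 * (1 + omega) ^ 2) := by
  rw [delta]; linear_combination (2 - omega ^ 2) * omega_pow_four

theorem sqrt_two_eq_delta_mul : (Real.sqrt 2 : ℂ) = delta * (omega * (1 + omega)) := by
  rw [delta, ofReal_sqrt_two_eq]; ring

theorem delta_sq_eq : delta ^ 2 = (Real.sqrt 2 : ℂ) * (omega - omega ^ 2 - 1) := by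
  rw [delta, ofReal_sqrt_two_eq]; linear_combination (1 - omega) * omega_pow_four

/-- Modulo `δ` the number `a + bω + cω² + dω³` is the parity of `a + b + c + d`, since `ω ≡ 1` and
`2 ≡ 0`. -/
theorem div_delta_mem_of_coords (a b c d : ℤ) :
    (Even (a + b + c + d) →
      (a + b * omega + c * omega ^ 2 + d * omega ^ 3 : ℂ) / delta ∈ zOmega) ∧
    (Odd (a + b + c + d) →
      (a + b * omega + c * omega ^ 2 + d * omega ^ 3 - 1 : ℂ) / delta ∈ zOmega) := by
  have key : ∀ k e : ℤ, a + b + c + d = 2 * k + e →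
      (a + b * omega + c * omega ^ 2 + d * omega ^ 3 - e : ℂ) / delta ∈ zOmega := by
    intro k e h
    refine ⟨k - b - c - d, k - c - d, k - d, k, ?_⟩
    rw [div_eq_iff delta_ne_zero, delta]
    have h' : (a + b + c + d : ℂ) = 2 * k + e := by exact_mod_cast h
    push_cast
    linear_combination h' + k * omega_pow_four
  constructor
  · rintro ⟨k, hk⟩
    simpa using key k 0 (by omega)
  · rintro ⟨k, hk⟩
    simpa using key k 1 (by omega)

theorem div_delta_mem_or {x : ℂ} (hx : x ∈ zOmega) :
    x / delta ∈ zOmega ∨ (x - 1) / delta ∈ zOmega := by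
  obtain ⟨a, b, c, d, rfl⟩ := hx
  rcases Int.even_or_odd (a + b + c + d) with h | h
  · exact Or.inl ((div_delta_mem_of_coords a b c d).1 h)
  · exact Or.inr ((div_delta_mem_of_coords a b c d).2 h)

/-- Every unit of `ℤ[ω] / (δ³)` is the class of a power of `ω`. Modulo `δ⁴`, that is modulo `2`,
this is no longer true. -/
theorem exists_sub_omega_pow_div_mem {x : ℂ} (hx : x ∈ zOmega) (hodd : x / delta ∉ zOmega) :
    ∃ m : ℕ, (x - omega ^ m) / delta ^ 3 ∈ zOmega := by
  have hδ := delta_ne_zero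
  have hω := omega_mem
  have hδm := delta_mem
  have h2 : (omega ^ 2 * (1 + omega) ^ 2) ∈ zOmega :=
    mul_mem (pow_mem hω _) (pow_mem (add_mem (one_mem _) hω) _)
  -- The remainder of `x - ω^m` is a multiple of `δ³` plus one of `2δ`, and `2` is one of `δ²`.
  have close : ∀ (m : ℕ) (z c : ℂ), z ∈ zOmega → c ∈ zOmega →
      x - omega ^ m = delta ^ 3 * z + 2 * delta * c → ∃ m : ℕ,
        (x - omega ^ m) / delta ^ 3 ∈ zOmega := by
    intro m z c hz hc h
    refine ⟨m, ?_⟩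
    have e : (x - omega ^ m) / delta ^ 3 = z + (omega ^ 2 * (1 + omega) ^ 2) * c := by
      rw [div_eq_iff (pow_ne_zero _ hδ), h]
      linear_combination delta * c * two_eq_delta_sq_mul
    rw [e]
    exact add_mem hz (mul_mem h2 hc)
  have lift : ∀ y : ℂ, y = delta * (y / delta) := fun y => by field_simp
  have hω' : omega = 1 - delta := by rw [delta]; ring
  obtain ⟨y, hy, hxy⟩ : ∃ y ∈ zOmega, x = 1 + delta * y :=
    ⟨_, (div_delta_mem_or hx).resolve_left hodd, by rw [← lift]; ring⟩
  rcases div_delta_mem_or hy with h | h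
  · obtain ⟨z, hz, hyz⟩ : ∃ z ∈ zOmega, y = delta * z := ⟨_, h, lift y⟩
    rcases div_delta_mem_or hz with h | h
    · refine close 0 (z / delta) 0 h (zero_mem _) ?_
      rw [hxy, hyz]; field_simp; ring
    · refine close 2 ((z - 1) / delta) 1 h (one_mem _) ?_
      rw [hxy, hyz, hω']; field_simp; ring
  · obtain ⟨z, hz, hyz⟩ : ∃ z ∈ zOmega, y = 1 + delta * z :=
      ⟨_, h, by rw [← lift]; ring⟩
    rcases div_delta_mem_or hz with h | h
    · refine close 1 (z / delta) 1 h (one_mem _) ?_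
      rw [hxy, hyz, hω']; field_simp; ring
    · refine close 3 ((z - 1) / delta + 1) (2 - delta) (add_mem h (one_mem _))
        (sub_mem (by simp) hδm) ?_
      rw [hxy, hyz, hω']; field_simp; ring

theorem exists_sub_omega_pow_mul_div_mem {x y : ℂ} (hx : x ∈ zOmega) (hy : y ∈ zOmega)
    (hx' : x / delta ∉ zOmega) (hy' : y / delta ∉ zOmega) :
    ∃ m : ℕ, (x - omega ^ m * y) / delta ^ 3 ∈ zOmega := by
  obtain ⟨k, hk⟩ := exists_sub_omega_pow_div_mem hx hx'
  obtain ⟨l, hl⟩ := exists_sub_omega_pow_div_mem hy hy'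
  refine ⟨k + 7 * l, ?_⟩
  have e : (x - omega ^ (k + 7 * l) * y) / delta ^ 3
      = (x - omega ^ k) / delta ^ 3 - omega ^ (k + 7 * l) * ((y - omega ^ l) / delta ^ 3) := by
    have h8 : omega ^ (k + 7 * l) * omega ^ l = omega ^ k := by
      rw [← pow_add, show k + 7 * l + l = k + 8 * l by ring, pow_add, pow_mul,
        omega_pow_eight, one_pow, mul_one]
    rw [← mul_div_assoc, ← sub_div]
    congr 1
    linear_combination -h8
  rw [e]
  exact sub_mem hk (mul_mem (pow_mem omega_mem _) hl)

/-- Two odd numerators become divisible by `δ` when, after a phase on the second one, they are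
mapped to `(x - ω^m y)/√2` and `(x + ω^m y)/√2`. -/
theorem exists_pair_reduction {x y : ℂ} (hx : x ∈ zOmega) (hy : y ∈ zOmega)
    (hx' : x / delta ∉ zOmega) (hy' : y / delta ∉ zOmega) :
    ∃ m : ℕ, (x - omega ^ m * y) / Real.sqrt 2 / delta ∈ zOmega ∧
      (x + omega ^ m * y) / Real.sqrt 2 / delta ∈ zOmega := by
  obtain ⟨m, hm⟩ := exists_sub_omega_pow_mul_div_mem hx hy hx' hy'
  have hδ := delta_ne_zero
  have hs := ofReal_sqrt_two_ne_zero
  have h1 : (x - omega ^ m * y) / Real.sqrt 2 / delta ∈ zOmega := by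
    have e : (x - omega ^ m * y) / Real.sqrt 2 / delta
        = (x - omega ^ m * y) / delta ^ 3 * (omega - omega ^ 2 - 1) := by
      field_simp
      linear_combination (x - omega ^ m * y) * delta_sq_eq
    rw [e]
    exact mul_mem hm (sub_mem (sub_mem omega_mem (pow_mem omega_mem _)) (one_mem _))
  refine ⟨m, h1, ?_⟩
  have e : (x + omega ^ m * y) / Real.sqrt 2 / delta
      = (x - omega ^ m * y) / Real.sqrt 2 / delta
        + omega ^ m * y * (omega * (1 + omega)) := by
    field_simp
    linear_combination (-omega ^ m * y) * ofReal_sqrt_two_sq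
      + (omega ^ m * y * Real.sqrt 2) * sqrt_two_eq_delta_mul
  rw [e]
  exact add_mem h1 (mul_mem (mul_mem (pow_mem omega_mem _) hy)
    (mul_mem omega_mem (add_mem (one_mem _) omega_mem)))

/-- The squared absolute value of an element of `ℤ[ω]` is `s + t√2` with `s` a sum of the squares
of the coordinates. Its parity decides divisibility by `δ`, and `s = 1` only for powers of `ω`. -/
theorem exists_norm_sq_coords {x : ℂ} (hx : x ∈ zOmega) :
    ∃ (s : ℕ) (t : ℤ), ‖x‖ ^ 2 = s + t * Real.sqrt 2 ∧ (Odd s ↔ x / delta ∉ zOmega) ∧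
      (s = 0 → x = 0) ∧ (s = 1 → ∃ m : ℕ, x = omega ^ m) := by
  obtain ⟨a, b, c, d, rfl⟩ := hx
  obtain ⟨s, hs⟩ := Int.eq_ofNat_of_zero_le (show 0 ≤ a ^ 2 + b ^ 2 + c ^ 2 + d ^ 2 by positivity)
  have hn := norm_sq_zOmega a b c d
  rw [hs] at hn
  refine ⟨s, _, by simpa only [Int.cast_natCast] using hn, ?_, ?_, ?_⟩
  · have hpar : Odd s ↔ Odd (a + b + c + d) := by
      rw [← Int.odd_coe_nat, ← hs]
      simp only [Int.odd_add, Int.odd_pow, ← Int.not_odd_iff_even]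
      simp
    rw [hpar]
    constructor
    · rintro ho ⟨a', b', c', d', h⟩
      -- A multiple of `δ` has an even first coordinate of the norm, since `|δ|² = 2 - √2`.
      have hmul : (a + b * omega + c * omega ^ 2 + d * omega ^ 3 : ℂ)
          = delta * (a' + b' * omega + c' * omega ^ 2 + d' * omega ^ 3) := by
        rw [← h]; field_simp [delta_ne_zero]
      rw [hmul, norm_mul, mul_pow, norm_delta_sq, norm_sq_zOmega] at hn
      set S := a' ^ 2 + b' ^ 2 + c' ^ 2 + d' ^ 2
      set U := a' * b' - a' * d' + b' * c' + c' * d'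
      have h2 : Real.sqrt 2 ^ 2 = 2 := Real.sq_sqrt (by norm_num)
      have := sqrt_two_coords_unique (a := 2 * S - 2 * U) (b := 2 * U - S)
        (c := ((s : ℕ) : ℤ)) (d := a * b - a * d + b * c + c * d) (by
          push_cast at hn ⊢
          linear_combination hn + (U : ℝ) * h2)
      have hs' := hpar.mpr ho
      rw [← Int.odd_coe_nat, ← this.1] at hs'
      obtain ⟨k, hk⟩ := hs'
      omega
    · intro h
      by_contra hc
      exact h ((div_delta_mem_of_coords a b c d).1 (Int.not_odd_iff_even.mp hc))
  · rintro rfl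
    have sq := fun z : ℤ => sq_nonneg z
    rw [Nat.cast_zero] at hs
    have zero : ∀ z : ℤ, z ^ 2 ≤ 0 → z = 0 := fun z hz => by
      exact pow_eq_zero_iff two_ne_zero |>.mp (le_antisymm hz (sq z))
    rw [zero a (by linarith [sq a, sq b, sq c, sq d]), zero b (by linarith [sq a, sq b, sq c, sq d]),
      zero c (by linarith [sq a, sq b, sq c, sq d]), zero d (by linarith [sq a, sq b, sq c, sq d])]
    simp
  · rintro rfl
    have bound : ∀ z : ℤ, z ^ 2 ≤ 1 → z = -1 ∨ z = 0 ∨ z = 1 := by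
      intro z hz
      have h1 : -1 ≤ z := by nlinarith
      have h2 : z ≤ 1 := by nlinarith
      omega
    have sq := fun z : ℤ => sq_nonneg z
    rw [Nat.cast_one] at hs
    have ha := bound a (by linarith [sq a, sq b, sq c, sq d])
    have hb := bound b (by linarith [sq a, sq b, sq c, sq d])
    have hc := bound c (by linarith [sq a, sq b, sq c, sq d])
    have hd := bound d (by linarith [sq a, sq b, sq c, sq d])
    -- A sum of four squares is `1` only if one coordinate is `±1` and the others vanish; the sign
    -- is `ω⁴`.
    have neg : ∀ j : ℕ, -omega ^ j = omega ^ (j + 4) := fun j => by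
      rw [pow_add, omega_pow_four]; ring
    rcases ha with rfl | rfl | rfl <;> rcases hb with rfl | rfl | rfl <;>
      rcases hc with rfl | rfl | rfl <;> rcases hd with rfl | rfl | rfl <;>
      first
      | (exfalso; norm_num at hs; done)
      | exact ⟨0, by push_cast; ring1⟩
      | exact ⟨1, by push_cast; ring1⟩
      | exact ⟨2, by push_cast; ring1⟩
      | exact ⟨3, by push_cast; ring1⟩
      | exact ⟨4, by rw [← neg 0]; push_cast; ring1⟩
      | exact ⟨5, by rw [← neg 1]; push_cast; ring1⟩
      | exact ⟨6, by rw [← neg 2]; push_cast; ring1⟩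
      | exact ⟨7, by rw [← neg 3]; push_cast; ring1⟩

/-- The powers of `|δ|² = 2 - √2` have an even rational part. -/
theorem exists_norm_delta_pow_coords (K : ℕ) :
    ∃ A B : ℤ, (‖delta‖ ^ 2) ^ (K + 1) = A + B * Real.sqrt 2 ∧ Even A := by
  have h2 : Real.sqrt 2 ^ 2 = 2 := Real.sq_sqrt (by norm_num)
  induction K with
  | zero => exact ⟨2, -1, by rw [norm_delta_sq]; push_cast; ring, by decide⟩
  | succ K ih =>
    obtain ⟨A, B, h, -⟩ := ih
    refine ⟨2 * A - 2 * B, 2 * B - A, ?_, ⟨A - B, by ring⟩⟩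
    rw [pow_succ, h, norm_delta_sq]
    push_cast
    linear_combination -(B : ℝ) * h2

/-- The ring `ℤ[ω, 1/δ]` as a subring of `ℂ`; it is `ℤ[i, 1/√2]`, written with powers of `δ` as
denominators. -/
noncomputable def zOmegaLoc : Subring ℂ where
  carrier := {x | ∃ K : ℕ, delta ^ K * x ∈ zOmega}
  mul_mem' := by
    rintro x y ⟨K, hK⟩ ⟨L, hL⟩
    exact ⟨K + L, by rw [pow_add, mul_mul_mul_comm]; exact mul_mem hK hL⟩
  one_mem' := ⟨0, by simp⟩
  add_mem' := by
    rintro x y ⟨K, hK⟩ ⟨L, hL⟩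
    refine ⟨K + L, ?_⟩
    rw [show delta ^ (K + L) * (x + y)
      = delta ^ L * (delta ^ K * x) + delta ^ K * (delta ^ L * y) by ring]
    exact add_mem (mul_mem (pow_mem delta_mem _) hK) (mul_mem (pow_mem delta_mem _) hL)
  zero_mem' := ⟨0, by simp⟩
  neg_mem' := by
    rintro x ⟨K, hK⟩
    exact ⟨K, by rw [mul_neg]; exact neg_mem hK⟩

theorem omega_mem_loc : omega ∈ zOmegaLoc := ⟨0, by simpa using omega_mem⟩

theorem I_mem_loc : Complex.I ∈ zOmegaLoc := omega_sq ▸ pow_mem omega_mem_loc 2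

theorem inv_sqrt_two_mem_loc : 1 / (Real.sqrt 2 : ℂ) ∈ zOmegaLoc := by
  refine ⟨2, ?_⟩
  have e : delta ^ 2 * (1 / (Real.sqrt 2 : ℂ)) = omega - omega ^ 2 - 1 := by
    rw [delta_sq_eq]; field_simp [ofReal_sqrt_two_ne_zero]
  rw [e]
  exact sub_mem (sub_mem omega_mem (pow_mem omega_mem _)) (one_mem _)

theorem half_mem_loc : (1 / 2 : ℂ) ∈ zOmegaLoc := by
  have := mul_mem inv_sqrt_two_mem_loc inv_sqrt_two_mem_loc
  rwa [← ofReal_sqrt_two_sq, show 1 / (Real.sqrt 2 : ℂ) ^ 2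
    = 1 / (Real.sqrt 2 : ℂ) * (1 / (Real.sqrt 2 : ℂ)) by ring]

theorem ringZISqrt_le_loc {x : ℂ} (hx : x ∈ ringZISqrt) : x ∈ zOmegaLoc := by
  refine Algebra.adjoin_induction ?_ ?_ ?_ ?_ hx
  · rintro y (rfl | rfl)
    · exact I_mem_loc
    · exact inv_sqrt_two_mem_loc
  · intro r
    simp
  · exact fun _ _ _ _ => add_mem
  · exact fun _ _ _ _ => mul_mem

theorem exists_common_denominator {κ : Type*} [Fintype κ] {v : κ → ℂ}
    (hv : ∀ i, v i ∈ zOmegaLoc) : ∃ K : ℕ, ∀ i, delta ^ K * v i ∈ zOmega := by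
  choose K hK using hv
  refine ⟨∑ i, K i, fun i => ?_⟩
  have hle : K i ≤ ∑ i, K i := Finset.single_le_sum (fun _ _ => Nat.zero_le _) (Finset.mem_univ i)
  rw [← Nat.sub_add_cancel hle, pow_add, mul_assoc]
  exact mul_mem (pow_mem delta_mem _) (hK i)

/-! ### Controlled gates without ancillas -/

theorem circuitOp_append {ι : Type} [Fintype ι] [DecidableEq ι] (L L' : List (CliffordTGate ι)) :
    circuitOp (L ++ L') = circuitOp L' * circuitOp L := by
  induction L with
  | nil => simp [circuitOp]
  | cons g L ih => simp [circuitOp, ih, mul_assoc]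

/-- The operators that are realized exactly by a Clifford+T circuit on the register `ι`, without
further ancillas. -/
def synthesizable (ι : Type) [Fintype ι] [DecidableEq ι] : Submonoid (QOp ι) where
  carrier := Set.range circuitOp
  mul_mem' := by
    rintro _ _ ⟨L, rfl⟩ ⟨L', rfl⟩
    exact ⟨L' ++ L, circuitOp_append _ _⟩
  one_mem' := ⟨[], rfl⟩

/-- The operator that acts on qubit `t` by the matrix `G x`, where `x` is the content of the other
qubits. -/
noncomputable def blockHom {ι : Type} [Fintype ι] [DecidableEq ι] (t : ι) :
    (({j // j ≠ t} → Fin 2) → Matrix (Fin 2) (Fin 2) ℂ) →* QOp ι :=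
  ((Matrix.reindexRingEquiv ℂ (Equiv.funSplitAt t (Fin 2)).symm).toRingHom.comp
    (Matrix.blockDiagonalRingHom (Fin 2) ({j // j ≠ t} → Fin 2) ℂ)).toMonoidHom

/-- The content of the qubits other than `t`. -/
def restrictOff {ι : Type} (t : ι) (x : Bits ι) : {j // j ≠ t} → Fin 2 := fun j => x j

theorem restrictOff_eq_iff {ι : Type} (t : ι) (x y : Bits ι) :
    restrictOff t x = restrictOff t y ↔ ∀ j, j ≠ t → x j = y j := by
  simp [restrictOff, funext_iff]

section Blocks

variable {ι : Type} [Fintype ι] [DecidableEq ι]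

theorem blockHom_apply (t : ι) (G : ({j // j ≠ t} → Fin 2) → Matrix (Fin 2) (Fin 2) ℂ)
    (x y : Bits ι) : blockHom t G x y
      = if restrictOff t x = restrictOff t y then G (restrictOff t x) (x t) (y t) else 0 := rfl

theorem onQubit_eq_blockHom (t : ι) (g : Matrix (Fin 2) (Fin 2) ℂ) :
    onQubit t g = blockHom t (fun _ => g) := by
  ext x y
  simp only [onQubit, blockHom_apply, restrictOff_eq_iff]

/-- The blocks of a controlled gate: `g` where the qubits in `A` agree with the pattern `p`. -/
def controlled {t : ι} (A : Finset {j // j ≠ t}) (p : {j // j ≠ t} → Fin 2)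
    (g : Matrix (Fin 2) (Fin 2) ℂ) : ({j // j ≠ t} → Fin 2) → Matrix (Fin 2) (Fin 2) ℂ :=
  fun x => if ∀ a ∈ A, x a = p a then g else 1

theorem cnotOp_eq_blockHom (t : ι) (c : {j // j ≠ t}) :
    cnotOp (c : ι) t = blockHom t (controlled {c} (fun _ => 1) !![0, 1; 1, 0]) := by
  ext x y
  have hc : restrictOff t x c = x c := rfl
  simp only [cnotOp, blockHom_apply, controlled, restrictOff_eq_iff, Finset.mem_singleton,
    forall_eq, hc]
  have h : x = Function.update y t (y t + y c) ↔ (∀ j, j ≠ t → x j = y j) ∧ x t = y t + x c := by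
    constructor
    · intro h
      have h1 : ∀ j, j ≠ t → x j = y j := fun j hj => by
        rw [h, Function.update_of_ne hj]
      refine ⟨h1, ?_⟩
      rw [h1 c c.2, h, Function.update_self]
    · rintro ⟨h1, h2⟩
      ext j
      by_cases hj : j = t
      · subst hj
        rw [Function.update_self, h2, h1 c c.2]
      · rw [Function.update_of_ne hj, h1 j hj]
  simp only [h]
  by_cases h1 : ∀ j, j ≠ t → x j = y j
  · rw [if_pos h1]
    simp only [eq_true h1, true_and]
    generalize x c = u
    generalize x t = a
    generalize y t = b
    fin_cases u <;> fin_cases a <;> fin_cases b <;> simp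
  · simp only [h1, false_and, if_false]

/-- The block functions on qubit `t` that are realized by circuits. -/
noncomputable def blockSynth (t : ι) : Submonoid (({j // j ≠ t} → Fin 2) → Matrix (Fin 2) (Fin 2) ℂ) :=
  (synthesizable ι).comap (blockHom t)

theorem gate_mem_synthesizable (g : CliffordTGate ι) : g.op ∈ synthesizable ι :=
  ⟨[g], by simp [circuitOp]⟩

theorem const_mul_mem_blockSynth {t : ι} {g h : Matrix (Fin 2) (Fin 2) ℂ}
    (hg : (fun _ => g) ∈ blockSynth t) (hh : (fun _ => h) ∈ blockSynth t) :
    (fun _ => g * h) ∈ blockSynth t := mul_mem hg hh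

theorem const_pow_mem_blockSynth {t : ι} {g : Matrix (Fin 2) (Fin 2) ℂ}
    (hg : (fun _ => g) ∈ blockSynth t) (k : ℕ) : (fun _ => g ^ k) ∈ blockSynth t :=
  pow_mem hg k

theorem hadamardMat_mem_blockSynth (t : ι) : (fun _ => hadamardMat) ∈ blockSynth t := by
  rw [blockSynth, Submonoid.mem_comap, ← onQubit_eq_blockHom]
  exact gate_mem_synthesizable (.H t)

theorem tMat_eq : tMat = !![1, 0; 0, omega] := rfl

theorem tMat_pow (k : ℕ) : tMat ^ k = !![1, 0; 0, omega ^ k] := by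
  induction k with
  | zero => rw [pow_zero, pow_zero, Matrix.one_fin_two]
  | succ k ih => rw [pow_succ, ih, tMat_eq, pow_succ]; simp

theorem phase_mem_blockSynth (t : ι) (k : ℕ) :
    (fun _ => !![1, 0; 0, omega ^ k]) ∈ blockSynth t := by
  rw [← tMat_pow]
  refine const_pow_mem_blockSynth ?_ k
  rw [blockSynth, Submonoid.mem_comap, ← onQubit_eq_blockHom]
  exact gate_mem_synthesizable (.T t)

theorem matrix_two_eq {a b c d a' b' c' d' : ℂ} (ha : a = a') (hb : b = b') (hc : c = c')
    (hd : d = d') : !![a, b; c, d] = !![a', b'; c', d'] := by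
  rw [ha, hb, hc, hd]

theorem hadamard_conj (a b c d : ℂ) : hadamardMat * !![a, b; c, d] * hadamardMat
    = !![(a + b + c + d) / 2, (a - b + c - d) / 2; (a + b - c - d) / 2, (a - b - c + d) / 2] := by
  have h : (Real.sqrt 2 : ℂ)⁻¹ * (Real.sqrt 2 : ℂ)⁻¹ = 1 / 2 := by
    rw [← mul_inv, ← sq, ofReal_sqrt_two_sq]; norm_num
  rw [hadamardMat]
  simp only [one_div, Matrix.smul_mul, Matrix.mul_smul, smul_smul, h]
  ext i j
  fin_cases i <;> fin_cases j <;> simp <;> ring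

theorem hadamard_mul_self : hadamardMat * hadamardMat = 1 := by
  have := hadamard_conj 1 0 0 1
  rw [← Matrix.one_fin_two, mul_one] at this
  rw [this, Matrix.one_fin_two]; norm_num

theorem flip_mem_blockSynth (t : ι) : (fun _ => !![0, 1; 1, 0]) ∈ blockSynth t := by
  have h := const_mul_mem_blockSynth (const_mul_mem_blockSynth (hadamardMat_mem_blockSynth t)
    (phase_mem_blockSynth t 4)) (hadamardMat_mem_blockSynth t)
  rw [hadamard_conj, omega_pow_four] at h
  norm_num at h
  exact h

theorem controlled_mul {t : ι} (A : Finset {j // j ≠ t}) (p : {j // j ≠ t} → Fin 2)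
    (g h : Matrix (Fin 2) (Fin 2) ℂ) :
    controlled A p g * controlled A p h = controlled A p (g * h) := by
  ext1 x
  simp only [Pi.mul_apply, controlled]
  split_ifs <;> simp

theorem controlled_pow_mem {t : ι} {A : Finset {j // j ≠ t}} {p : {j // j ≠ t} → Fin 2}
    {g : Matrix (Fin 2) (Fin 2) ℂ} (hg : controlled A p g ∈ blockSynth t) (k : ℕ) :
    controlled A p (g ^ k) ∈ blockSynth t := by
  induction k with
  | zero =>
    have : controlled A p (g ^ 0) = 1 := by ext1 x; simp [controlled]
    rw [this]; exact one_mem _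
  | succ k ih => rw [pow_succ, ← controlled_mul]; exact mul_mem ih hg

/-- Conjugating a controlled gate by an uncontrolled one conjugates the gate. -/
theorem controlled_conj_mem {t : ι} {A : Finset {j // j ≠ t}} {p : {j // j ≠ t} → Fin 2}
    {g h h' : Matrix (Fin 2) (Fin 2) ℂ} (hg : controlled A p g ∈ blockSynth t)
    (hh : (fun _ => h) ∈ blockSynth t) (hh' : (fun _ => h') ∈ blockSynth t) (hinv : h * h' = 1) :
    controlled A p (h * g * h') ∈ blockSynth t := by
  have e : controlled A p (h * g * h') = (fun _ => h) * controlled A p g * (fun _ => h') := by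
    ext1 x
    simp only [Pi.mul_apply, controlled]
    split_ifs <;> simp [hinv]
  rw [e]
  exact mul_mem (mul_mem hh hg) hh'

/-- The commutator of a gate with controls `A` and one with controls `B` is the commutator of the
gates, with controls `A ∪ B`. -/
theorem controlled_commutator_mem {t : ι} {A B : Finset {j // j ≠ t}} {p : {j // j ≠ t} → Fin 2}
    {g g' h h' : Matrix (Fin 2) (Fin 2) ℂ} (hg : controlled A p g ∈ blockSynth t)
    (hg' : controlled A p g' ∈ blockSynth t) (hh : controlled B p h ∈ blockSynth t)
    (hh' : controlled B p h' ∈ blockSynth t) (hgg : g * g' = 1) (hhh : h * h' = 1) :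
    controlled (A ∪ B) p (g * h * g' * h') ∈ blockSynth t := by
  have e : controlled (A ∪ B) p (g * h * g' * h')
      = controlled A p g * controlled B p h * controlled A p g' * controlled B p h' := by
    ext1 x
    have hAB : (∀ a ∈ A ∪ B, x a = p a) ↔ (∀ a ∈ A, x a = p a) ∧ ∀ a ∈ B, x a = p a := by
      simp only [Finset.mem_union, or_imp, forall_and]
    have key : ∀ (P Q : Prop) [Decidable P] [Decidable Q],
        (if P ∧ Q then g * h * g' * h' else 1) = (if P then g else 1) * (if Q then h else 1)
          * (if P then g' else 1) * (if Q then h' else 1) := by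
      intro P Q _ _
      by_cases hP : P <;> by_cases hQ : Q <;> simp [hP, hQ, hgg, hhh]
    simp only [Pi.mul_apply, controlled, hAB, key]
  rw [e]
  exact mul_mem (mul_mem (mul_mem hg hh) hg') hh'

theorem controlled_empty {t : ι} (p : {j // j ≠ t} → Fin 2) (g : Matrix (Fin 2) (Fin 2) ℂ) :
    controlled ∅ p g = fun _ => g := by
  ext1 x; simp [controlled]

theorem controlled_flip_singleton_mem {t : ι} (c : {j // j ≠ t}) (p : {j // j ≠ t} → Fin 2) :
    controlled {c} p !![0, 1; 1, 0] ∈ blockSynth t := by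
  have h1 : controlled {c} (fun _ => 1) !![0, 1; 1, 0] ∈ blockSynth t := by
    rw [blockSynth, Submonoid.mem_comap, ← cnotOp_eq_blockHom]
    exact gate_mem_synthesizable (.CNOT (c : ι) t c.2)
  by_cases hp : p c = 1
  · have e : controlled {c} p !![0, 1; 1, 0] = controlled {c} (fun _ => 1) !![0, 1; 1, 0] := by
      ext1 x; simp [controlled, hp]
    rw [e]; exact h1
  · have e : controlled {c} p !![0, 1; 1, 0]
        = (fun _ => !![0, 1; 1, 0]) * controlled {c} (fun _ => 1) !![0, 1; 1, 0] := by
      have hp0 : p c = 0 := by omega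
      ext1 x
      simp only [controlled, Finset.mem_singleton, forall_eq, hp0, Pi.mul_apply]
      rcases (show x c = 0 ∨ x c = 1 by omega) with h | h <;>
        simp [h, Matrix.one_fin_two]
    rw [e]; exact mul_mem (flip_mem_blockSynth t) h1

/-- `T X T⁻¹`. -/
theorem phase_conj_flip : !![1, 0; 0, omega ^ 1] * !![0, 1; 1, 0] * !![1, 0; 0, omega ^ 7]
    = !![0, omega ^ 7; omega, 0] := by simp

/-- The gate `iX` with any number of controls needs no ancilla: it is, up to a conjugation by `H`,
the commutator of an `iX` with one control less and a controlled `T X T⁻¹`, where the missing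
phase in `X` instead of `iX` drops out. -/
theorem controlled_iX_mem {t : ι} (A : Finset {j // j ≠ t}) (p : {j // j ≠ t} → Fin 2) :
    controlled A p !![0, omega ^ 2; omega ^ 2, 0] ∈ blockSynth t := by
  have conjH : ∀ {B : Finset {j // j ≠ t}},
      controlled B p !![omega ^ 2, 0; 0, -omega ^ 2] ∈ blockSynth t →
      controlled B p !![0, omega ^ 2; omega ^ 2, 0] ∈ blockSynth t := by
    intro B h
    have := controlled_conj_mem h (hadamardMat_mem_blockSynth t) (hadamardMat_mem_blockSynth t)
      hadamard_mul_self
    rw [hadamard_conj] at this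
    convert this using 3
    all_goals ring_nf
  have hTinv : !![1, 0; 0, omega ^ 1] * !![1, 0; 0, omega ^ 7]
      = (1 : Matrix (Fin 2) (Fin 2) ℂ) := by
    rw [Matrix.one_fin_two, Matrix.mul_fin_two]
    exact matrix_two_eq (by ring) (by ring) (by ring) (by linear_combination omega_pow_eight)
  have hY : !![0, omega ^ 7; omega, 0] * !![0, omega ^ 7; omega, 0]
      = (1 : Matrix (Fin 2) (Fin 2) ℂ) := by
    rw [Matrix.one_fin_two, Matrix.mul_fin_two]
    exact matrix_two_eq (by linear_combination omega_pow_eight) (by ring) (by ring)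
      (by linear_combination omega_pow_eight)
  induction A using Finset.induction with
  | empty =>
    apply conjH
    have hX := flip_mem_blockSynth t
    have hTXT : (fun _ => !![0, omega ^ 7; omega, 0]) ∈ blockSynth t := by
      rw [← phase_conj_flip]
      exact const_mul_mem_blockSynth (const_mul_mem_blockSynth (phase_mem_blockSynth t 1) hX)
        (phase_mem_blockSynth t 7)
    rw [controlled_empty]
    convert const_mul_mem_blockSynth (const_mul_mem_blockSynth
      (const_mul_mem_blockSynth hX hTXT) hX) hTXT using 2
    simp only [Matrix.mul_fin_two]
    exact matrix_two_eq (by ring) (by ring) (by ring)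
      (by linear_combination (-omega ^ 2 - omega ^ 6 * (omega ^ 4 - 1)) * omega_pow_four)
  | insert b A hb ih =>
    apply conjH
    have hX := controlled_flip_singleton_mem b p
    have hTXT : controlled {b} p !![0, omega ^ 7; omega, 0] ∈ blockSynth t := by
      rw [← phase_conj_flip]
      exact controlled_conj_mem hX (phase_mem_blockSynth t 1) (phase_mem_blockSynth t 7) hTinv
    have := controlled_commutator_mem ih (controlled_pow_mem ih 3) hTXT hTXT (by
      simp only [pow_succ, pow_zero, one_mul, Matrix.mul_fin_two]
      rw [Matrix.one_fin_two]
      exact matrix_two_eq (by linear_combination omega_pow_eight) (by ring) (by ring)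
        (by linear_combination omega_pow_eight)) hY
    rw [Finset.union_comm, ← Finset.insert_eq] at this
    convert this using 2
    simp only [pow_succ, pow_zero, one_mul, Matrix.mul_fin_two]
    refine matrix_two_eq (by linear_combination (-omega ^ 2) * omega_pow_eight) (by ring)
      (by ring) ?_
    linear_combination
      (-omega ^ 2 * (omega ^ 16 - omega ^ 12 + omega ^ 8 - omega ^ 4 + 1)) * omega_pow_four

/-- The gate `diag(ω, ω⁻¹)` with any number of controls is the commutator of a controlled `iX` and
an uncontrolled `T`. -/
theorem controlled_phase_mem {t : ι} (A : Finset {j // j ≠ t}) (p : {j // j ≠ t} → Fin 2) :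
    controlled A p !![omega, 0; 0, omega ^ 7] ∈ blockSynth t := by
  have h1 := controlled_iX_mem A p
  have hT : controlled ∅ p !![1, 0; 0, omega ^ 1] ∈ blockSynth t := by
    rw [controlled_empty]; exact phase_mem_blockSynth t 1
  have hT' : controlled ∅ p !![1, 0; 0, omega ^ 7] ∈ blockSynth t := by
    rw [controlled_empty]; exact phase_mem_blockSynth t 7
  have := controlled_commutator_mem h1 (controlled_pow_mem h1 3) hT hT' (by
      simp only [pow_succ, pow_zero, one_mul, Matrix.mul_fin_two]
      rw [Matrix.one_fin_two]
      exact matrix_two_eq (by linear_combination omega_pow_eight) (by ring) (by ring)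
        (by linear_combination omega_pow_eight)) (by
      rw [Matrix.one_fin_two, Matrix.mul_fin_two]
      exact matrix_two_eq (by ring) (by ring) (by ring) (by linear_combination omega_pow_eight))
  rw [Finset.union_empty] at this
  convert this using 2
  simp only [pow_succ, pow_zero, one_mul, Matrix.mul_fin_two]
  exact matrix_two_eq (by linear_combination (-omega) * omega_pow_eight) (by ring) (by ring)
    (by linear_combination (-omega ^ 7) * omega_pow_eight)

/-- The rotation of the plane by the angle `π/4`. -/
noncomputable def planeRotation : Matrix (Fin 2) (Fin 2) ℂ :=
  !![1 / (Real.sqrt 2 : ℂ), -(1 / (Real.sqrt 2 : ℂ));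
    1 / (Real.sqrt 2 : ℂ), 1 / (Real.sqrt 2 : ℂ)]

/-- The rotation by `π/4` is conjugate to `diag(ω, ω⁻¹)` in the Clifford group. -/
theorem controlled_rotation_mem {t : ι} (A : Finset {j // j ≠ t}) (p : {j // j ≠ t} → Fin 2) :
    controlled A p planeRotation ∈ blockSynth t := by
  have h1 := controlled_conj_mem (controlled_phase_mem A p) (hadamardMat_mem_blockSynth t)
    (hadamardMat_mem_blockSynth t) hadamard_mul_self
  rw [hadamard_conj] at h1
  have h2 := controlled_conj_mem h1 (phase_mem_blockSynth t 6) (phase_mem_blockSynth t 2) (by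
      rw [Matrix.one_fin_two, Matrix.mul_fin_two]
      exact matrix_two_eq (by ring) (by ring) (by ring) (by linear_combination omega_pow_eight))
  convert h2 using 2
  have hs : 1 / (Real.sqrt 2 : ℂ) = (omega - omega ^ 3) / 2 := by
    rw [← ofReal_sqrt_two_eq, div_eq_div_iff ofReal_sqrt_two_ne_zero two_ne_zero]
    linear_combination -ofReal_sqrt_two_sq
  rw [planeRotation, hs]
  simp only [Matrix.mul_fin_two]
  refine matrix_two_eq ?_ ?_ ?_ ?_
  · linear_combination (-omega ^ 3 / 2) * omega_pow_four
  · linear_combination (omega / 2) * omega_pow_eight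
  · linear_combination (omega / 2 * (omega ^ 8 - omega ^ 4 + 1) - omega ^ 3 / 2) * omega_pow_four
  · linear_combination (-omega / 2) * omega_pow_eight
      - omega ^ 3 / 2 * (omega ^ 8 - omega ^ 4 + 1) * omega_pow_four

/-- Conjugation by an uncontrolled `X` exchanges the two levels of the target qubit. -/
theorem controlled_flipConj_mem {t : ι} {A : Finset {j // j ≠ t}} {p : {j // j ≠ t} → Fin 2}
    {a b c d : ℂ} (h : controlled A p !![a, b; c, d] ∈ blockSynth t) :
    controlled A p !![d, c; b, a] ∈ blockSynth t := by
  have := controlled_conj_mem h (flip_mem_blockSynth t) (flip_mem_blockSynth t) (by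
    rw [Matrix.one_fin_two]; simp)
  convert this using 2
  simp

end Blocks

/-! ### Two-level operators -/

section TwoLevel

variable {κ : Type*} [Fintype κ] [DecidableEq κ]

/-- The two-level operator that acts by `g` on the span of the basis vectors `p`, `q` and fixes the
other basis vectors. It is meant for `p ≠ q`. -/
noncomputable def twoLevel (p q : κ) (g : Matrix (Fin 2) (Fin 2) ℂ) : Matrix κ κ ℂ :=
  Matrix.of fun i j =>
    if i = p then (if j = p then g 0 0 else if j = q then g 0 1 else 0)
    else if i = q then (if j = p then g 1 0 else if j = q then g 1 1 else 0)
    else if i = j then 1 else 0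

theorem twoLevel_mulVec {p q : κ} (hpq : p ≠ q) (g : Matrix (Fin 2) (Fin 2) ℂ) (v : κ → ℂ) :
    twoLevel p q g *ᵥ v = fun i =>
      if i = p then g 0 0 * v p + g 0 1 * v q
      else if i = q then g 1 0 * v p + g 1 1 * v q else v i := by
  have two : ∀ a b : ℂ, ∑ j, (if j = p then a else if j = q then b else 0) * v j
      = a * v p + b * v q := by
    intro a b
    have : ∀ j, (if j = p then a else if j = q then b else 0) * v j
        = (if j = p then a * v j else 0) + (if j = q then b * v j else 0) := by
      intro j
      by_cases h1 : j = p
      · subst h1; simp [hpq]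
      · simp [h1]
    simp [this, Finset.sum_add_distrib]
  ext i
  rw [Matrix.mulVec_eq_sum, Finset.sum_apply]
  by_cases h1 : i = p
  · simpa [twoLevel, h1, mul_comm] using two (g 0 0) (g 0 1)
  · by_cases h2 : i = q
    · subst h2
      simpa [twoLevel, h1, mul_comm] using two (g 1 0) (g 1 1)
    · simp [twoLevel, h1, h2]

theorem twoLevel_mul {p q : κ} (hpq : p ≠ q) (g h : Matrix (Fin 2) (Fin 2) ℂ) :
    twoLevel p q g * twoLevel p q h = twoLevel p q (g * h) := by
  refine Matrix.ext_of_mulVec_single fun j => ?_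
  rw [← Matrix.mulVec_mulVec]
  simp only [twoLevel_mulVec hpq]
  ext i
  simp only [hpq.symm, if_true, if_false, Matrix.mul_apply, Fin.sum_univ_two]
  split_ifs <;> ring

theorem twoLevel_one {p q : κ} (hpq : p ≠ q) : twoLevel p q 1 = 1 := by
  refine Matrix.ext_of_mulVec_single fun j => ?_
  ext i
  rw [twoLevel_mulVec hpq, Matrix.one_mulVec]
  by_cases h1 : i = p
  · simp [h1]
  · by_cases h2 : i = q
    · subst h2; simp [h1]
    · simp [h1, h2]

theorem twoLevel_swap {p q : κ} (hpq : p ≠ q) (a b c d : ℂ) :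
    twoLevel q p !![a, b; c, d] = twoLevel p q !![d, c; b, a] := by
  refine Matrix.ext_of_mulVec_single fun j => ?_
  rw [twoLevel_mulVec hpq, twoLevel_mulVec hpq.symm]
  ext i
  by_cases h1 : i = p
  · subst h1; simp [hpq, add_comm]
  · by_cases h2 : i = q
    · subst h2; simp [h1, add_comm]
    · simp [h1, h2]

theorem twoLevel_pow {p q : κ} (hpq : p ≠ q) (g : Matrix (Fin 2) (Fin 2) ℂ) (k : ℕ) :
    twoLevel p q g ^ k = twoLevel p q (g ^ k) := by
  induction k with
  | zero => rw [pow_zero, pow_zero, twoLevel_one hpq]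
  | succ k ih => rw [pow_succ, ih, twoLevel_mul hpq, pow_succ]

/-- A rotation by a right angle in the plane of `q` and `r` carries two-level operators on `p`, `q`
to two-level operators on `p`, `r`. -/
theorem twoLevel_conj {p q r : κ} (hpq : p ≠ q) (hqr : q ≠ r) (hpr : p ≠ r)
    (g : Matrix (Fin 2) (Fin 2) ℂ) :
    twoLevel q r !![0, -1; 1, 0] * twoLevel p q g * twoLevel q r !![0, 1; -1, 0]
      = twoLevel p r g := by
  refine Matrix.ext_of_mulVec_single fun j => ?_
  rw [← Matrix.mulVec_mulVec, ← Matrix.mulVec_mulVec]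
  simp only [twoLevel_mulVec hpq, twoLevel_mulVec hqr, twoLevel_mulVec hpr]
  ext i
  by_cases h1 : i = p
  · subst h1
    simp [hpq, hpr]
  · by_cases h2 : i = q
    · subst h2
      simp [hpq, hpq.symm, hpr, hpr.symm, hqr, hqr.symm]
    · by_cases h3 : i = r
      · subst h3
        simp [hpq, hpq.symm, hpr, hpr.symm, hqr.symm]
      · simp [h1, h2, h3]

end TwoLevel

theorem planeRotation_sq : planeRotation ^ 2 = !![0, -1; 1, 0] := by
  have h : (Real.sqrt 2 : ℂ)⁻¹ * (Real.sqrt 2 : ℂ)⁻¹ = 1 / 2 := by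
    rw [← mul_inv, ← sq, ofReal_sqrt_two_sq]; norm_num
  rw [sq, planeRotation]
  simp only [one_div, Matrix.mul_fin_two, mul_neg, neg_mul, h]
  exact matrix_two_eq (by ring) (by ring) (by ring) (by ring)

theorem planeRotation_pow_four : planeRotation ^ 4 = -1 := by
  rw [show planeRotation ^ 4 = (planeRotation ^ 2) ^ 2 by rw [← pow_mul], planeRotation_sq, sq,
    Matrix.mul_fin_two, Matrix.one_fin_two]
  simp

theorem planeRotation_pow_six : planeRotation ^ 6 = !![0, 1; -1, 0] := by
  rw [pow_add planeRotation 4 2, planeRotation_pow_four, planeRotation_sq]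
  simp

section Synthesis

variable {ι : Type} [Fintype ι] [DecidableEq ι]

/-- With all other qubits as controls, a gate on qubit `t` is a two-level operator on two basis states
that differ in the bit `t` only. -/
theorem blockHom_controlled_univ (t : ι) (x : Bits ι) (g : Matrix (Fin 2) (Fin 2) ℂ) :
    blockHom t (controlled Finset.univ (restrictOff t x) g)
      = twoLevel (Function.update x t 0) (Function.update x t 1) g := by
  have hres : ∀ (y : Bits ι) (a : Fin 2),
      y = Function.update x t a ↔ restrictOff t y = restrictOff t x ∧ y t = a := by
    intro y a
    rw [restrictOff_eq_iff]
    constructor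
    · rintro rfl
      exact ⟨fun j hj => Function.update_of_ne hj _ _, Function.update_self _ _ _⟩
    · rintro ⟨h1, h2⟩
      ext j
      by_cases hj : j = t
      · subst hj; rw [Function.update_self, h2]
      · rw [Function.update_of_ne hj, h1 j hj]
  have heq : ∀ y z : Bits ι, y = z ↔ restrictOff t y = restrictOff t z ∧ y t = z t := by
    intro y z
    rw [restrictOff_eq_iff]
    constructor
    · rintro rfl; simp
    · rintro ⟨h1, h2⟩
      ext j
      by_cases hj : j = t
      · subst hj; rw [h2]
      · rw [h1 j hj]
  ext y z
  have hfun : (∀ a ∈ Finset.univ, restrictOff t y a = restrictOff t x a)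
      ↔ restrictOff t y = restrictOff t x := by simp [funext_iff]
  simp only [blockHom_apply, controlled, hfun, twoLevel, Matrix.of_apply, hres, heq y z]
  generalize restrictOff t x = X
  generalize restrictOff t y = Y
  generalize restrictOff t z = Z
  generalize y t = b
  generalize z t = c
  by_cases h1 : Y = X
  · subst h1
    by_cases h2 : Y = Z
    · subst h2
      fin_cases b <;> fin_cases c <;> simp
    · fin_cases b <;> simp [h2, Ne.symm h2, eq_comm]
  · by_cases h2 : Y = Z
    · subst h2
      simp [h1, Matrix.one_apply]
    · simp [h1, h2]

/-- The pairs of basis states on which the two-level operators `diag(ω, ω⁻¹)` and rotation by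
`π/4` are realized by circuits. -/
def LevelsLinked (p q : Bits ι) : Prop :=
  twoLevel p q planeRotation ∈ synthesizable ι ∧
    twoLevel p q !![omega, 0; 0, omega ^ 7] ∈ synthesizable ι

theorem levelsLinked_of_adjacent (x : Bits ι) (t : ι) (a b : Fin 2) (hab : a ≠ b) :
    LevelsLinked (Function.update x t a) (Function.update x t b) := by
  have h01 : Function.update x t (0 : Fin 2) ≠ Function.update x t 1 := fun h => by
    simpa using congrFun h t
  have mem : ∀ {g : Matrix (Fin 2) (Fin 2) ℂ}, controlled Finset.univ (restrictOff t x) g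
      ∈ blockSynth t →
      twoLevel (Function.update x t 0) (Function.update x t 1) g ∈ synthesizable ι := by
    intro g hg
    rw [← blockHom_controlled_univ]
    exact hg
  have hR := controlled_rotation_mem (t := t) Finset.univ (restrictOff t x)
  have hP := controlled_phase_mem (t := t) Finset.univ (restrictOff t x)
  rcases (show (a = 0 ∧ b = 1) ∨ (a = 1 ∧ b = 0) by omega) with ⟨rfl, rfl⟩ | ⟨rfl, rfl⟩
  · exact ⟨mem hR, mem hP⟩
  · constructor
    · rw [planeRotation, twoLevel_swap h01]
      exact mem (controlled_flipConj_mem hR)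
    · rw [twoLevel_swap h01]
      exact mem (controlled_flipConj_mem hP)

theorem LevelsLinked.trans {p q r : Bits ι} (hpq : p ≠ q) (hqr : q ≠ r) (hpr : p ≠ r)
    (h1 : LevelsLinked p q) (h2 : LevelsLinked q r) : LevelsLinked p r := by
  have hR := pow_mem h2.1 2
  rw [twoLevel_pow hqr, planeRotation_sq] at hR
  have hR' := pow_mem h2.1 6
  rw [twoLevel_pow hqr, planeRotation_pow_six] at hR'
  constructor
  · rw [← twoLevel_conj hpq hqr hpr]
    exact mul_mem (mul_mem hR h1.1) hR'
  · rw [← twoLevel_conj hpq hqr hpr]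
    exact mul_mem (mul_mem hR h1.2) hR'

/-- Any two basis states are joined by a path that changes one bit at a time. -/
theorem levelsLinked (p q : Bits ι) (hpq : p ≠ q) : LevelsLinked p q := by
  have key : ∀ A : Finset ι, p = A.piecewise q p ∨ LevelsLinked p (A.piecewise q p) := by
    intro A
    induction A using Finset.induction with
    | empty => left; simp
    | insert t A ht ih =>
      rw [Finset.piecewise_insert]
      set m := A.piecewise q p with hm
      by_cases h1 : p = Function.update m t (q t)
      · exact Or.inl h1
      right
      by_cases h2 : m = Function.update m t (q t)
      · rw [← h2] at h1 ⊢
        exact ih.resolve_left h1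
      have hmt : m t ≠ q t := fun h => h2 (by rw [← h, Function.update_eq_self])
      have hlink : LevelsLinked m (Function.update m t (q t)) := by
        have := levelsLinked_of_adjacent m t (m t) (q t) hmt
        rwa [Function.update_eq_self] at this
      rcases ih with h | h
      · rwa [← h] at hlink ⊢
      · by_cases hpm : p = m
        · rw [hpm]; exact hlink
        · exact h.trans hpm h2 h1 hlink
  have := key Finset.univ
  rw [Finset.piecewise_univ] at this
  exact this.resolve_left hpq

end Synthesis

/-! ### Unitarity and entries of circuits -/

section CircuitProperties

variable {ι : Type} [Fintype ι] [DecidableEq ι]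

theorem star_blockHom (t : ι) (G : ({j // j ≠ t} → Fin 2) → Matrix (Fin 2) (Fin 2) ℂ) :
    star (blockHom t G) = blockHom t (fun x => star (G x)) := by
  ext x y
  simp only [Matrix.star_apply, blockHom_apply]
  by_cases h : restrictOff t x = restrictOff t y
  · rw [if_pos h, if_pos h.symm, h]
  · rw [if_neg h, if_neg (Ne.symm h), star_zero]

theorem star_hadamardMat : star hadamardMat = hadamardMat := by
  ext i j
  fin_cases i <;> fin_cases j <;> simp [hadamardMat, Matrix.star_apply]

theorem star_tMat : star tMat = tMat ^ 7 := by
  rw [tMat_pow, tMat_eq, ← star_omega]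
  ext i j
  fin_cases i <;> fin_cases j <;> simp [Matrix.star_apply]

theorem gate_op_star (g : CliffordTGate ι) :
    star g.op ∈ synthesizable ι ∧ g.op * star g.op = 1 := by
  cases g with
  | H t =>
    have h : star (CliffordTGate.H t).op = (CliffordTGate.H t).op := by
      simp only [CliffordTGate.op, onQubit_eq_blockHom, star_blockHom, star_hadamardMat]
    rw [h]
    refine ⟨gate_mem_synthesizable _, ?_⟩
    simp only [CliffordTGate.op, onQubit_eq_blockHom, ← map_mul]
    rw [← map_one (blockHom t)]
    congr 1
    ext1 x
    exact hadamard_mul_self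
  | T t =>
    have h : star (CliffordTGate.T t).op = (CliffordTGate.T t).op ^ 7 := by
      simp only [CliffordTGate.op, onQubit_eq_blockHom, star_blockHom, star_tMat, ← map_pow]
      rfl
    rw [h]
    refine ⟨pow_mem (gate_mem_synthesizable _) 7, ?_⟩
    rw [← pow_succ']
    simp only [CliffordTGate.op, onQubit_eq_blockHom, ← map_pow]
    rw [← map_one (blockHom t)]
    congr 1
    ext1 x
    simp [tMat_pow, omega_pow_eight, Matrix.one_fin_two]
  | CNOT c t hct =>
    have hop : (CliffordTGate.CNOT c t hct).op
        = blockHom t (controlled {⟨c, hct⟩} (fun _ => 1) !![0, 1; 1, 0]) :=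
      cnotOp_eq_blockHom t ⟨c, hct⟩
    have hX : star (!![0, 1; 1, 0] : Matrix (Fin 2) (Fin 2) ℂ) = !![0, 1; 1, 0] := by
      ext i j
      fin_cases i <;> fin_cases j <;> simp [Matrix.star_apply]
    have h : star (CliffordTGate.CNOT c t hct).op = (CliffordTGate.CNOT c t hct).op := by
      rw [hop, star_blockHom]
      congr 1
      ext1 x
      simp only [controlled]
      split_ifs
      · exact hX
      · exact star_one _
    rw [h]
    refine ⟨gate_mem_synthesizable _, ?_⟩
    rw [hop, ← map_mul, controlled_mul, ← map_one (blockHom t)]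
    congr 1
    ext1 x
    simp [controlled, Matrix.one_fin_two]

theorem star_mem_synthesizable {U : QOp ι} (hU : U ∈ synthesizable ι) :
    star U ∈ synthesizable ι := by
  obtain ⟨L, rfl⟩ := hU
  induction L with
  | nil => simp [circuitOp, one_mem]
  | cons g L ih =>
    rw [circuitOp, star_mul]
    exact mul_mem (gate_op_star g).1 ih

theorem mul_star_of_synthesizable {U : QOp ι} (hU : U ∈ synthesizable ι) : U * star U = 1 := by
  obtain ⟨L, rfl⟩ := hU
  induction L with
  | nil => simp [circuitOp]
  | cons g L ih =>
    rw [circuitOp, star_mul, mul_assoc, ← mul_assoc g.op, (gate_op_star g).2, one_mul, ih]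

theorem star_mul_of_synthesizable {U : QOp ι} (hU : U ∈ synthesizable ι) : star U * U = 1 :=
  mul_eq_one_comm.mp (mul_star_of_synthesizable hU)

theorem gate_op_apply_mem_loc (g : CliffordTGate ι) (x y : Bits ι) : g.op x y ∈ zOmegaLoc := by
  cases g with
  | H t =>
    simp only [CliffordTGate.op, onQubit]
    split_ifs
    · generalize x t = a
      generalize y t = b
      have := inv_sqrt_two_mem_loc
      rw [one_div] at this
      fin_cases a <;> fin_cases b <;> simp [hadamardMat, this]
    · exact zero_mem _
  | T t =>
    simp only [CliffordTGate.op, onQubit, tMat_eq]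
    split_ifs
    · generalize x t = a
      generalize y t = b
      fin_cases a <;> fin_cases b <;> simp [omega_mem_loc, one_mem]
    · exact zero_mem _
  | CNOT c t hct =>
    simp only [CliffordTGate.op, cnotOp]
    split_ifs
    · exact one_mem _
    · exact zero_mem _

theorem apply_mem_loc_of_synthesizable {U : QOp ι} (hU : U ∈ synthesizable ι) (x y : Bits ι) :
    U x y ∈ zOmegaLoc := by
  obtain ⟨L, rfl⟩ := hU
  induction L generalizing x y with
  | nil =>
    rw [circuitOp, Matrix.one_apply]
    split_ifs
    · exact one_mem _
    · exact zero_mem _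
  | cons g L ih =>
    rw [circuitOp, Matrix.mul_apply]
    exact sum_mem fun z _ => mul_mem (ih x z) (gate_op_apply_mem_loc g z y)

theorem star_mulVec_dotProduct_mulVec {U : QOp ι} (hU : U ∈ synthesizable ι)
    (v w : Bits ι → ℂ) : star (U *ᵥ v) ⬝ᵥ (U *ᵥ w) = star v ⬝ᵥ w := by
  rw [Matrix.star_mulVec, Matrix.dotProduct_mulVec, Matrix.vecMul_vecMul,
    ← Matrix.star_eq_conjTranspose, star_mul_of_synthesizable hU, Matrix.vecMul_one]

/-- The synthesizable operators that fix the basis states in `F`. -/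
def synthesizableFixing (F : Finset (Bits ι)) : Submonoid (QOp ι) where
  carrier := {U | U ∈ synthesizable ι ∧ ∀ f ∈ F, U *ᵥ Pi.single f 1 = Pi.single f 1}
  mul_mem' := by
    rintro U W ⟨hU, hUf⟩ ⟨hW, hWf⟩
    refine ⟨mul_mem hU hW, fun f hf => ?_⟩
    rw [← Matrix.mulVec_mulVec, hWf f hf, hUf f hf]
  one_mem' := ⟨one_mem _, fun f _ => Matrix.one_mulVec _⟩

/-- A unitary that fixes a basis state also preserves the coordinate along it. -/
theorem mulVec_apply_of_fixing {F : Finset (Bits ι)} {U : QOp ι}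
    (hU : U ∈ synthesizableFixing F) (v : Bits ι → ℂ) {f : Bits ι} (hf : f ∈ F) :
    (U *ᵥ v) f = v f := by
  have h := star_mulVec_dotProduct_mulVec hU.1 (Pi.single f 1) v
  rw [hU.2 f hf] at h
  simpa using h

theorem twoLevel_mem_fixing {F : Finset (Bits ι)} {p q : Bits ι} (hpq : p ≠ q) (hp : p ∉ F)
    (hq : q ∉ F) {g : Matrix (Fin 2) (Fin 2) ℂ} (hg : twoLevel p q g ∈ synthesizable ι) :
    twoLevel p q g ∈ synthesizableFixing F := by
  refine ⟨hg, fun f hf => ?_⟩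
  have hpf : p ≠ f := fun h => hp (h ▸ hf)
  have hqf : q ≠ f := fun h => hq (h ▸ hf)
  rw [twoLevel_mulVec hpq]
  ext i
  by_cases h1 : i = p
  · subst h1; simp [hpf, hqf]
  · by_cases h2 : i = q
    · subst h2; simp [hpf, hqf]
    · simp [h1, h2]

theorem diag_pow (a b : ℂ) (k : ℕ) : !![a, 0; 0, b] ^ k = !![a ^ k, 0; 0, b ^ k] := by
  induction k with
  | zero => simp [Matrix.one_fin_two]
  | succ k ih => rw [pow_succ, ih]; simp [pow_succ]

end CircuitProperties

/-! ### Reduction of columns -/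

section Columns

variable {ι : Type} [Fintype ι] [DecidableEq ι]

theorem sum_norm_sq_of_unit {κ : Type*} [Fintype κ] {v : κ → ℂ} (hv : star v ⬝ᵥ v = 1) :
    ∑ i, ‖v i‖ ^ 2 = 1 := by
  have h : star v ⬝ᵥ v = ((∑ i, ‖v i‖ ^ 2 : ℝ) : ℂ) := by
    simp only [dotProduct, Pi.star_apply, Complex.star_def, Complex.ofReal_sum]
    refine Finset.sum_congr rfl fun i _ => ?_
    rw [mul_comm, Complex.mul_conj, Complex.normSq_eq_norm_sq]
  rw [h] at hv
  exact_mod_cast hv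

/-- In a unit vector with denominator `δ^(K+1)`, an even number of entries has a numerator that is
not divisible by `δ`: the squared absolute values of the numerators add up to `|δ|^(2K+2)`, and
modulo `δ` each of them is `1` or `0` according to divisibility. -/
theorem even_card_odd_numerators {κ : Type*} [Fintype κ] {v : κ → ℂ} (hv : star v ⬝ᵥ v = 1)
    {K : ℕ} (hK : ∀ i, delta ^ (K + 1) * v i ∈ zOmega)
    (B : Finset κ) (hB : ∀ i, i ∈ B ↔ delta ^ K * v i ∉ zOmega) : Even B.card := by
  have hdiv : ∀ i, delta ^ (K + 1) * v i / delta = delta ^ K * v i := fun i => by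
    rw [pow_succ, div_eq_iff delta_ne_zero]; ring
  choose s t hst hodd _ _ using fun i => exists_norm_sq_coords (hK i)
  obtain ⟨A, C, hAC, hA⟩ := exists_norm_delta_pow_coords K
  have hsum : ∑ i, ‖delta ^ (K + 1) * v i‖ ^ 2 = (‖delta‖ ^ 2) ^ (K + 1) := by
    have : ∀ i, ‖delta ^ (K + 1) * v i‖ ^ 2 = (‖delta‖ ^ 2) ^ (K + 1) * ‖v i‖ ^ 2 := fun i => by
      rw [norm_mul, norm_pow]; ring
    simp only [this]
    rw [← Finset.mul_sum, sum_norm_sq_of_unit hv, mul_one]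
  simp only [hst, Finset.sum_add_distrib, ← Finset.sum_mul] at hsum
  have hA' := (sqrt_two_coords_unique (a := ((∑ i, s i : ℕ) : ℤ)) (b := ∑ i, t i)
    (c := A) (d := C) (by push_cast; rw [hsum, hAC])).1
  rw [← hA', Int.even_coe_nat] at hA
  rw [← Nat.not_odd_iff_even, Finset.odd_sum_iff_odd_card_odd, Nat.not_odd_iff_even] at hA
  convert hA using 2
  ext i
  simp [hB, hodd, hdiv]

/-- A unit vector with entries in `ℤ[ω]` is a basis vector times a power of `ω`. -/
theorem exists_eq_single_of_unit {κ : Type*} [Fintype κ] [DecidableEq κ] {v : κ → ℂ}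
    (hv : star v ⬝ᵥ v = 1) (hmem : ∀ i, v i ∈ zOmega) :
    ∃ (q : κ) (m : ℕ), v = Pi.single q (omega ^ m) := by
  choose s t hst _ hzero hone using fun i => exists_norm_sq_coords (hmem i)
  have hsum := sum_norm_sq_of_unit hv
  simp only [hst, Finset.sum_add_distrib, ← Finset.sum_mul] at hsum
  have hs := (sqrt_two_coords_unique (a := ((∑ i, s i : ℕ) : ℤ)) (b := ∑ i, t i)
    (c := 1) (d := 0) (by push_cast; rw [hsum]; simp)).1
  have hs' : ∑ i, s i = 1 := by exact_mod_cast hs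
  obtain ⟨q, -, hq⟩ := Finset.exists_ne_zero_of_sum_ne_zero (by rw [hs']; exact one_ne_zero)
  have hrest := Finset.add_sum_erase Finset.univ s (Finset.mem_univ q)
  rw [hs'] at hrest
  obtain ⟨m, hm⟩ := hone q (by omega)
  refine ⟨q, m, ?_⟩
  have h0 : ∑ i ∈ Finset.univ.erase q, s i = 0 := by omega
  rw [Finset.sum_eq_zero_iff] at h0
  ext i
  by_cases h : i = q
  · subst h; simp [hm]
  · rw [Pi.single_eq_of_ne h]
    exact hzero i (h0 i (by simp [h]))

/-- Outside the finished levels `F` there is a level besides any two given ones. -/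
theorem exists_filler {κ : Type*} [Fintype κ] [DecidableEq κ] {F : Finset κ}
    (hF : F.card + 2 < Fintype.card κ) (p q : κ) : ∃ f, f ∉ F ∧ f ≠ p ∧ f ≠ q := by
  have h : (insert p (insert q F)).card < (Finset.univ : Finset κ).card := by
    have h1 := Finset.card_insert_le p (insert q F)
    have h2 := Finset.card_insert_le q F
    rw [Finset.card_univ]
    omega
  obtain ⟨f, -, hf⟩ := Finset.exists_mem_notMem_of_card_lt_card h
  simp only [Finset.mem_insert, not_or] at hf
  exact ⟨f, hf.2.2, hf.1, hf.2.1⟩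

/-- Two entries with odd numerators are made even. The phase that aligns them is compensated on a
third level `f`, whose phase is irrelevant. -/
theorem exists_pair_step {F : Finset (Bits ι)} {v : Bits ι → ℂ} {K : ℕ}
    (hK : ∀ i, delta ^ (K + 1) * v i ∈ zOmega) {p q f : Bits ι} (hpq : p ≠ q) (hfp : f ≠ p)
    (hfq : f ≠ q) (hpF : p ∉ F) (hqF : q ∉ F) (hfF : f ∉ F)
    (hp : delta ^ K * v p ∉ zOmega) (hq : delta ^ K * v q ∉ zOmega) :
    ∃ U ∈ synthesizableFixing F, (∀ i, delta ^ (K + 1) * (U *ᵥ v) i ∈ zOmega) ∧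
      delta ^ K * (U *ᵥ v) p ∈ zOmega ∧
      ∀ i, delta ^ K * v i ∈ zOmega → delta ^ K * (U *ᵥ v) i ∈ zOmega := by
  have hδ := delta_ne_zero
  have hdiv : ∀ i, delta ^ (K + 1) * v i / delta = delta ^ K * v i := fun i => by
    rw [pow_succ, div_eq_iff hδ]; ring
  obtain ⟨m, h1, h2⟩ := exists_pair_reduction (hK p) (hK q) (by rwa [hdiv]) (by rwa [hdiv])
  have hP := pow_mem (levelsLinked q f hfq.symm).2 m
  rw [twoLevel_pow hfq.symm, diag_pow] at hP
  refine ⟨twoLevel p q planeRotation * twoLevel q f !![omega ^ m, 0; 0, (omega ^ 7) ^ m],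
    mul_mem (twoLevel_mem_fixing hpq hpF hqF (levelsLinked p q hpq).1)
      (twoLevel_mem_fixing hfq.symm hqF hfF hP), ?_⟩
  set w := (twoLevel p q planeRotation * twoLevel q f !![omega ^ m, 0; 0, (omega ^ 7) ^ m]) *ᵥ v
    with hw
  have hwi : ∀ i, w i = if i = p then (v p - omega ^ m * v q) / Real.sqrt 2
      else if i = q then (v p + omega ^ m * v q) / Real.sqrt 2
      else if i = f then (omega ^ 7) ^ m * v f else v i := by
    intro i
    rw [hw, ← Matrix.mulVec_mulVec, twoLevel_mulVec hpq, twoLevel_mulVec hfq.symm]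
    by_cases hi : i = p
    · simp [hi, hpq, hfp.symm, planeRotation]; ring
    · by_cases hi' : i = q
      · subst hi'
        simp [hpq, hi, hfp.symm, planeRotation]; ring
      · simp [hi, hi']
  have hup : ∀ {z : ℂ}, delta ^ K * z ∈ zOmega → delta ^ (K + 1) * z ∈ zOmega := by
    intro z hz
    rw [pow_succ', mul_assoc]
    exact mul_mem delta_mem hz
  have hω : (omega ^ 7) ^ m ∈ zOmega := pow_mem (pow_mem omega_mem _) _
  have hwp : delta ^ K * w p ∈ zOmega := by
    rw [hwi, if_pos rfl]
    convert h1 using 1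
    rw [pow_succ]; field_simp
  have hwq : delta ^ K * w q ∈ zOmega := by
    rw [hwi, if_neg hpq.symm, if_pos rfl]
    convert h2 using 1
    rw [pow_succ]; field_simp
  refine ⟨fun i => ?_, hwp, fun i hi => ?_⟩
  · by_cases hip : i = p
    · rw [hip]; exact hup hwp
    by_cases hiq : i = q
    · rw [hiq]; exact hup hwq
    rw [hwi, if_neg hip, if_neg hiq]
    split_ifs with hif
    · rw [mul_left_comm]; exact mul_mem hω (hK f)
    · exact hK i
  · by_cases hip : i = p
    · rw [hip]; exact hwp
    by_cases hiq : i = q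
    · rw [hiq]; exact hwq
    rw [hwi, if_neg hip, if_neg hiq]
    split_ifs with hif
    · rw [mul_left_comm, ← hif]; exact mul_mem hω hi
    · exact hi

/-- The odd numerators over `δ^(K+1)` are removed two at a time, which uses that their number is
even; `N` bounds it. Then `δ^K` is a common denominator. -/
theorem exists_reduce_denominator {F : Finset (Bits ι)}
    (hF : F.card + 2 < Fintype.card (Bits ι)) (K N : ℕ) :
    ∀ {v : Bits ι → ℂ}, star v ⬝ᵥ v = 1 → (∀ f ∈ F, v f = 0) →
      (∀ i, delta ^ (K + 1) * v i ∈ zOmega) →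
      ∀ B : Finset (Bits ι), (∀ i, i ∈ B ↔ delta ^ K * v i ∉ zOmega) → B.card ≤ N →
      ∃ U ∈ synthesizableFixing F, ∀ i, delta ^ K * (U *ᵥ v) i ∈ zOmega := by
  classical
  induction N with
  | zero =>
    intro v _ _ _ B hB hcard
    refine ⟨1, one_mem _, fun i => ?_⟩
    rw [Matrix.one_mulVec]
    by_contra h
    have := Finset.card_pos.mpr ⟨i, (hB i).2 h⟩
    omega
  | succ N ih =>
    intro v hv hvF hK B hB hcard
    by_cases hBe : B.card ≤ N
    · exact ih hv hvF hK B hB hBe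
    have heven := even_card_odd_numerators hv hK B hB
    have hlt : 1 < B.card := by
      obtain ⟨k, hk⟩ := heven
      omega
    obtain ⟨p, hp, q, hq, hpq⟩ := Finset.one_lt_card.mp hlt
    have hnF : ∀ i ∈ B, i ∉ F := fun i hi hiF => by
      have := (hB i).1 hi
      rw [hvF i hiF, mul_zero] at this
      exact this (zero_mem _)
    obtain ⟨f, hfF, hfp, hfq⟩ := exists_filler hF p q
    obtain ⟨U, hU, hUK, hUp, hUi⟩ := exists_pair_step hK hpq hfp hfq (hnF p hp) (hnF q hq) hfF
      ((hB p).1 hp) ((hB q).1 hq)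
    have hsub : Finset.univ.filter (fun i => delta ^ K * (U *ᵥ v) i ∉ zOmega) ⊆ B.erase p := by
      intro i hi
      rw [Finset.mem_filter] at hi
      refine Finset.mem_erase.mpr ⟨fun h => hi.2 (h ▸ hUp), (hB i).2 fun h => hi.2 (hUi i h)⟩
    have hcard' := Finset.card_le_card hsub
    rw [Finset.card_erase_of_mem hp] at hcard'
    obtain ⟨W, hW, hWi⟩ := ih (v := U *ᵥ v) (by rw [star_mulVec_dotProduct_mulVec hU.1, hv])
      (fun f hf => by rw [mulVec_apply_of_fixing hU v hf, hvF f hf]) hUK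
      (Finset.univ.filter fun i => delta ^ K * (U *ᵥ v) i ∉ zOmega) (fun i => by simp) (by omega)
    exact ⟨W * U, mul_mem hW hU, fun i => by rw [← Matrix.mulVec_mulVec]; exact hWi i⟩

theorem exists_reduce_to_single {F : Finset (Bits ι)}
    (hF : F.card + 2 < Fintype.card (Bits ι)) (K : ℕ) :
    ∀ {v : Bits ι → ℂ}, star v ⬝ᵥ v = 1 → (∀ f ∈ F, v f = 0) →
      (∀ i, delta ^ K * v i ∈ zOmega) →
      ∃ U ∈ synthesizableFixing F, ∃ (q : Bits ι) (m : ℕ),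
        U *ᵥ v = Pi.single q (omega ^ m) := by
  classical
  induction K with
  | zero =>
    intro v hv _ hK
    refine ⟨1, one_mem _, ?_⟩
    rw [Matrix.one_mulVec]
    exact exists_eq_single_of_unit hv (by simpa using hK)
  | succ K ih =>
    intro v hv hvF hK
    obtain ⟨U, hU, hUK⟩ := exists_reduce_denominator hF K _ hv hvF hK
      (Finset.univ.filter fun i => delta ^ K * v i ∉ zOmega) (fun i => by simp) le_rfl
    obtain ⟨W, hW, hWv⟩ := ih (v := U *ᵥ v) (by rw [star_mulVec_dotProduct_mulVec hU.1, hv])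
      (fun f hf => by rw [mulVec_apply_of_fixing hU v hf, hvF f hf]) hUK
    exact ⟨W * U, mul_mem hW hU, by rwa [← Matrix.mulVec_mulVec]⟩

/-- A unit vector over `ℤ[i, 1/√2]` that vanishes on the basis states in `F` is mapped to a given
basis state outside `F` by a circuit that fixes those in `F`. -/
theorem exists_reduce_column {F : Finset (Bits ι)} (hF : F.card + 2 < Fintype.card (Bits ι))
    {v : Bits ι → ℂ} (hv : star v ⬝ᵥ v = 1) (hvF : ∀ f ∈ F, v f = 0)
    (hloc : ∀ i, v i ∈ zOmegaLoc) {r : Bits ι} (hr : r ∉ F) :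
    ∃ U ∈ synthesizableFixing F, U *ᵥ v = Pi.single r 1 := by
  obtain ⟨K, hK⟩ := exists_common_denominator hloc
  obtain ⟨U, hU, q, m, hUv⟩ := exists_reduce_to_single hF K hv hvF hK
  have hqF : q ∉ F := fun hq => by
    have := mulVec_apply_of_fixing hU v hq
    rw [hUv, hvF q hq, Pi.single_eq_same] at this
    exact pow_ne_zero _ omega_ne_zero this
  obtain ⟨W, hW, k, hWq⟩ : ∃ W ∈ synthesizableFixing F, ∃ k : ℕ,
      W *ᵥ Pi.single q (omega ^ m) = Pi.single r (omega ^ k) := by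
    by_cases hqr : q = r
    · exact ⟨1, one_mem _, m, by rw [Matrix.one_mulVec, hqr]⟩
    · refine ⟨twoLevel q r planeRotation ^ 2, pow_mem (twoLevel_mem_fixing hqr hqF hr
        (levelsLinked q r hqr).1) 2, m, ?_⟩
      rw [twoLevel_pow hqr, planeRotation_sq, twoLevel_mulVec hqr]
      ext i
      by_cases h1 : i = q
      · subst h1; simp [hqr, Ne.symm hqr]
      · by_cases h2 : i = r
        · subst h2; simp [h1]
        · simp [h1, h2]
  -- The remaining phase of `e_r` is removed; the opposite phase on level `f` meets the entry `0`.
  obtain ⟨f, hfF, hfr, -⟩ := exists_filler hF r r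
  have hP := pow_mem (twoLevel_mem_fixing hfr hfF hr (levelsLinked f r hfr).2) k
  refine ⟨_, mul_mem hP (mul_mem hW hU), ?_⟩
  rw [← Matrix.mulVec_mulVec, ← Matrix.mulVec_mulVec, hUv, hWq, twoLevel_pow hfr, diag_pow,
    twoLevel_mulVec hfr]
  have h8 : (omega ^ 7) ^ k * omega ^ k = 1 := by
    rw [← mul_pow, ← pow_succ, omega_pow_eight, one_pow]
  ext i
  by_cases h1 : i = f
  · subst h1; simp [hfr]
  · by_cases h2 : i = r
    · subst h2; simp [h1, h8]
    · simp [h1, h2]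

/-- An isometry with entries in `ℤ[i, 1/√2]` whose codomain has at least three dimensions more
than its domain is a part of the columns of a Clifford+T circuit without ancillas. -/
theorem exists_circuit_columns {β : Type*} [Fintype β] [DecidableEq β] (e : β ↪ Bits ι)
    (hβ : Fintype.card β + 2 < Fintype.card (Bits ι)) (v : β → Bits ι → ℂ)
    (hv : ∀ a b, star (v a) ⬝ᵥ v b = if a = b then 1 else 0)
    (hloc : ∀ b i, v b i ∈ zOmegaLoc) :
    ∃ U ∈ synthesizable ι, ∀ b i, U i (e b) = v b i := by
  have key : ∀ S : Finset β, ∃ U ∈ synthesizable ι, ∀ b ∈ S, U *ᵥ v b = Pi.single (e b) 1 := by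
    intro S
    induction S using Finset.induction with
    | empty => exact ⟨1, one_mem _, by simp⟩
    | insert b S hb ih =>
      obtain ⟨U, hU, hUS⟩ := ih
      have hcard : (S.map e).card + 2 < Fintype.card (Bits ι) := by
        rw [Finset.card_map]
        have := Finset.card_le_univ S
        omega
      obtain ⟨W, hW, hWb⟩ := exists_reduce_column (F := S.map e) (v := U *ᵥ v b) (r := e b) hcard
        (by rw [star_mulVec_dotProduct_mulVec hU, hv, if_pos rfl])
        (by
          intro f hf
          obtain ⟨a, ha, rfl⟩ := Finset.mem_map.mp hf
          have h := star_mulVec_dotProduct_mulVec hU (v a) (v b)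
          have hab : a ≠ b := fun hab => hb (hab ▸ ha)
          rw [hUS a ha, hv, if_neg hab] at h
          simpa using h)
        (fun i => sum_mem fun j _ =>
          mul_mem (apply_mem_loc_of_synthesizable hU i j) (hloc b j))
        (by simpa using hb)
      refine ⟨W * U, mul_mem hW.1 hU, fun a ha => ?_⟩
      rw [← Matrix.mulVec_mulVec]
      rcases Finset.mem_insert.mp ha with rfl | ha
      · exact hWb
      · rw [hUS a ha]
        exact hW.2 _ (Finset.mem_map_of_mem e ha)
  obtain ⟨U, hU, hUv⟩ := key Finset.univ
  refine ⟨star U, star_mem_synthesizable hU, fun b i => ?_⟩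
  have h : star U *ᵥ Pi.single (e b) 1 = v b := by
    rw [← hUv b (Finset.mem_univ b), Matrix.mulVec_mulVec, star_mul_of_synthesizable hU,
      Matrix.one_mulVec]
  rw [← h]
  simp

end Columns

/-! ### The repeat-until-success circuit -/

/-- A scalar multiple `c • V` has probability `‖c‖²` and phase `c / ‖c‖`; for `c = 0` the phase is
irrelevant and taken to be `1`. -/
theorem appliesWithProb_of_eq_smul {n : ℕ} {A V : QOp (Fin n)} (c : ℂ) (hc : ‖c‖ ≤ 1)
    (h : A = c • V) : AppliesWithProb A V (‖c‖ ^ 2) := by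
  refine ⟨by positivity, pow_le_one₀ (norm_nonneg c) hc, ?_⟩
  rw [Real.sqrt_sq (norm_nonneg c)]
  by_cases h0 : c = 0
  · exact ⟨1, by simp, by simp [h, h0]⟩
  · have hn : (‖c‖ : ℂ) ≠ 0 := by simpa using h0
    refine ⟨c / ‖c‖, by simp [h0], ?_⟩
    rw [h, mul_div_cancel₀ _ hn]

/-- Every natural number becomes a power of four after adding the squared absolute values of two
Gaussian integers. -/
theorem exists_gaussian_completion (k : ℕ) : ∃ z w : ℂ, z ∈ zOmegaLoc ∧ w ∈ zOmegaLoc ∧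
    (k : ℝ) + ‖z‖ ^ 2 + ‖w‖ ^ 2 = 4 ^ k := by
  obtain ⟨a, b, c, d, h⟩ := Nat.sum_four_squares (4 ^ k - k)
  have hk : k ≤ 4 ^ k := (Nat.lt_pow_self (by norm_num)).le
  have h' : (a ^ 2 + b ^ 2 + c ^ 2 + d ^ 2 + k : ℕ) = 4 ^ k := by omega
  have hR : (a ^ 2 + b ^ 2 + c ^ 2 + d ^ 2 + k : ℝ) = 4 ^ k := by exact_mod_cast h'
  have norm_gauss : ∀ x y : ℕ, ‖(x + y * Complex.I : ℂ)‖ ^ 2 = (x : ℝ) ^ 2 + (y : ℝ) ^ 2 := by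
    intro x y
    have := Complex.normSq_add_mul_I (x : ℝ) (y : ℝ)
    rw [Complex.normSq_eq_norm_sq] at this
    exact_mod_cast this
  have mem_gauss : ∀ x y : ℕ, (x + y * Complex.I : ℂ) ∈ zOmegaLoc := fun x y =>
    add_mem (natCast_mem _ x) (mul_mem (natCast_mem _ y) I_mem_loc)
  refine ⟨_, _, mem_gauss a b, mem_gauss c d, ?_⟩
  rw [norm_gauss, norm_gauss]
  linarith

/-- The operator that the ancilla outcome `s` is to apply, before normalization. The four outcomes
carry the blocks `M`, `z`, `w` and `0` of one block column. -/
def outcomeBlock {n : ℕ} (M : QOp (Fin n)) (z w : ℂ) (s : Bits (Fin 2)) : QOp (Fin n) :=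
  if s 0 = 0 then (if s 1 = 0 then M else z • 1) else (if s 1 = 0 then w • 1 else 0)

theorem sum_bits_fin_two {M : Type*} [AddCommMonoid M] (f : Bits (Fin 2) → M) :
    ∑ s, f s = f ![0, 0] + f ![0, 1] + f ![1, 0] + f ![1, 1] := by
  rw [← (finTwoArrowEquiv (Fin 2)).symm.sum_comp, Fintype.sum_prod_type]
  simp [finTwoArrowEquiv, add_assoc]

theorem sum_outcomeBlock {n : ℕ} {M : QOp (Fin n)} {z w : ℂ} {k : ℕ}
    (hM : star M * M = (k : ℂ) • 1) (hzw : (k : ℝ) + ‖z‖ ^ 2 + ‖w‖ ^ 2 = 4 ^ k) :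
    ∑ s, star (outcomeBlock M z w s) * outcomeBlock M z w s = (4 ^ k : ℂ) • 1 := by
  have hzw' : (k : ℂ) + star z * z + star w * w = 4 ^ k := by
    have hstar : ∀ c : ℂ, star c * c = ((‖c‖ ^ 2 : ℝ) : ℂ) := fun c => by
      rw [Complex.star_def, mul_comm, Complex.mul_conj, Complex.normSq_eq_norm_sq]
    rw [hstar, hstar]
    exact_mod_cast hzw
  rw [sum_bits_fin_two, ← hzw']
  simp [outcomeBlock, hM, star_smul, smul_smul, add_smul, mul_comm]

/-- The isometry with the blocks `outcomeBlock M z w s / 2^k` is the action of a circuit on the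
inputs with ancillas in the state `|00⟩`. -/
theorem exists_circuit_outcomeBlock {n : ℕ} {M : QOp (Fin n)} {z w : ℂ} {k : ℕ}
    (hM : star M * M = (k : ℂ) • 1) (hzw : (k : ℝ) + ‖z‖ ^ 2 + ‖w‖ ^ 2 = 4 ^ k)
    (hMloc : ∀ x y, M x y ∈ zOmegaLoc) (hz : z ∈ zOmegaLoc) (hw : w ∈ zOmegaLoc) :
    ∃ L : List (CliffordTGate (Fin n ⊕ Fin 2)), ∀ s x y,
      circuitOp L (Sum.elim x s) (Sum.elim y (fun _ => 0))
        = (1 / 2 : ℂ) ^ k * outcomeBlock M z w s x y := by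
  let e : Bits (Fin n) ↪ Bits (Fin n ⊕ Fin 2) :=
    ⟨fun y => Sum.elim y (fun _ => 0), fun y y' h => funext fun i => congrFun h (Sum.inl i)⟩
  let v : Bits (Fin n) → Bits (Fin n ⊕ Fin 2) → ℂ := fun y b =>
    (1 / 2 : ℂ) ^ k * outcomeBlock M z w (b ∘ Sum.inr) (b ∘ Sum.inl) y
  have hcard : Fintype.card (Bits (Fin n)) + 2 < Fintype.card (Bits (Fin n ⊕ Fin 2)) := by
    simp only [Fintype.card_fun, Fintype.card_sum, Fintype.card_fin, pow_add]
    have := Nat.one_le_two_pow (n := n)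
    omega
  have hv : ∀ a b, star (v a) ⬝ᵥ v b = if a = b then 1 else 0 := by
    intro a b
    have h4 : (4 : ℂ) ^ k ≠ 0 := pow_ne_zero _ (by norm_num)
    have h : star (v a) ⬝ᵥ v b = (1 / 4 : ℂ) ^ k
        * (∑ s, star (outcomeBlock M z w s) * outcomeBlock M z w s) a b := by
      rw [dotProduct, ← (Equiv.sumArrowEquivProdArrow (Fin n) (Fin 2) (Fin 2)).symm.sum_comp,
        Fintype.sum_prod_type_right, Matrix.sum_apply, Finset.mul_sum]
      refine Finset.sum_congr rfl fun s _ => ?_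
      rw [Matrix.mul_apply, Finset.mul_sum]
      refine Finset.sum_congr rfl fun x _ => ?_
      have hx : ∀ c, v c ((Equiv.sumArrowEquivProdArrow (Fin n) (Fin 2) (Fin 2)).symm (x, s))
          = (1 / 2 : ℂ) ^ k * outcomeBlock M z w s x c := fun c => rfl
      rw [Pi.star_apply, hx, hx, star_mul', Matrix.star_apply,
        show (1 / 4 : ℂ) = 1 / 2 * (1 / 2) by norm_num, mul_pow]
      have hs : star ((1 / 2 : ℂ) ^ k) = (1 / 2) ^ k := by simp
      rw [hs]
      ring
    rw [h, sum_outcomeBlock hM hzw, Matrix.smul_apply, Matrix.one_apply, smul_eq_mul, one_div,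
      inv_pow, inv_mul_cancel_left₀ h4]
  have hloc : ∀ b i, v b i ∈ zOmegaLoc := by
    intro b i
    refine mul_mem (pow_mem half_mem_loc k) ?_
    have h1 : ∀ x y : Bits (Fin n), (1 : QOp (Fin n)) x y ∈ zOmegaLoc := fun x y => by
      rw [Matrix.one_apply]
      split_ifs
      exacts [one_mem _, zero_mem _]
    rw [outcomeBlock]
    split_ifs
    · exact hMloc _ _
    · exact mul_mem hz (h1 _ _)
    · exact mul_mem hw (h1 _ _)
    · exact zero_mem _
  obtain ⟨_, ⟨L, rfl⟩, hL⟩ := exists_circuit_columns e hcard v hv hloc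
  exact ⟨L, fun s x y => hL y (Sum.elim x s)⟩

theorem mainTheorem3 (n : ℕ) (hn : 1 ≤ n) (V : QOp (Fin n))
    (hV : V ∈ Matrix.unitaryGroup (Bits (Fin n)) ℂ)
    (hα : ∃ α : ℂ, α ≠ 0 ∧ (∃ k : ℤ, ‖α‖ ^ 2 = (k : ℝ)) ∧
      ∀ x y, (α • V) x y ∈ ringZISqrt) :
    ∃ m : ℕ, n + m ≤ n + 2 ∧
      ∃ R : RUSCircuit n m, R.Implements V (fun _ => 1) := by
  obtain ⟨α, hα0, ⟨k', hk'⟩, hring⟩ := hα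
  obtain ⟨k, rfl⟩ := Int.eq_ofNat_of_zero_le (show 0 ≤ k' by
    have : (0 : ℝ) ≤ k' := hk' ▸ sq_nonneg ‖α‖
    exact_mod_cast this)
  have hk : ‖α‖ ^ 2 = (k : ℝ) := by exact_mod_cast hk'
  have hM : star (α • V) * (α • V) = (k : ℂ) • 1 := by
    have hs : star α * α = k := by
      rw [Complex.star_def, mul_comm, Complex.mul_conj, Complex.normSq_eq_norm_sq, hk]
      simp
    rw [star_smul, Matrix.smul_mul, Matrix.mul_smul, smul_smul, hs,
      Matrix.mem_unitaryGroup_iff'.mp hV]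
  obtain ⟨z, w, hz, hw, hzw⟩ := exists_gaussian_completion k
  obtain ⟨L, hL⟩ := exists_circuit_outcomeBlock hM hzw (fun x y => ringZISqrt_le_loc (hring x y))
    hz hw
  -- The coefficients of the blocks are bounded by `2^k`, since their squares add up to `4^k`.
  have hnorm : ∀ c : ℂ, ‖c‖ ^ 2 ≤ 4 ^ k → ‖(1 / 2 : ℂ) ^ k * c‖ ≤ 1 := by
    intro c hc
    have h2 : ‖c‖ ≤ 2 ^ k := by
      refine abs_le_of_sq_le_sq' ?_ (by positivity) |>.2
      rwa [← pow_mul, mul_comm k 2, pow_mul, show (2 : ℝ) ^ 2 = 4 by norm_num]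
    rw [norm_mul, norm_pow, show ‖(1 / 2 : ℂ)‖ = 1 / 2 by simp]
    calc (1 / 2 : ℝ) ^ k * ‖c‖ ≤ (1 / 2) ^ k * 2 ^ k := by gcongr
      _ = 1 := by rw [← mul_pow]; norm_num
  have hop : ∀ s, RUSCircuit.outcomeOp ⟨L, fun _ => 0⟩ s
      = (1 / 2 : ℂ) ^ k • outcomeBlock (α • V) z w s := by
    intro s
    ext x y
    exact hL s x y
  refine ⟨2, le_rfl, ⟨L, fun _ => 0⟩, hV, ⟨‖(1 / 2 : ℂ) ^ k * α‖ ^ 2, ?_, ?_⟩, fun s hs => ?_⟩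
  · have : (1 / 2 : ℂ) ^ k * α ≠ 0 := mul_ne_zero (pow_ne_zero _ (by norm_num)) hα0
    positivity
  · refine appliesWithProb_of_eq_smul _ (hnorm α ?_) ?_
    · nlinarith [sq_nonneg ‖z‖, sq_nonneg ‖w‖]
    · rw [hop, mul_smul]
      simp [outcomeBlock]
  · refine ⟨one_mem _, ?_⟩
    obtain ⟨c, hc, hcs⟩ : ∃ c : ℂ, ‖c‖ ^ 2 ≤ 4 ^ k ∧ outcomeBlock (α • V) z w s = c • 1 := by
      have h00 : ¬(s 0 = 0 ∧ s 1 = 0) := by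
        rintro ⟨h0, h1⟩
        exact hs (funext fun i => by fin_cases i <;> assumption)
      by_cases h0 : s 0 = 0
      · have h1 : s 1 ≠ 0 := fun h1 => h00 ⟨h0, h1⟩
        exact ⟨z, by nlinarith [sq_nonneg ‖α‖, sq_nonneg ‖w‖], by simp [outcomeBlock, h0, h1]⟩
      · by_cases h1 : s 1 = 0
        · exact ⟨w, by nlinarith [sq_nonneg ‖α‖, sq_nonneg ‖z‖], by simp [outcomeBlock, h0, h1]⟩
        · exact ⟨0, by simp, by simp [outcomeBlock, h0, h1]⟩
    refine ⟨_, appliesWithProb_of_eq_smul _ (hnorm c hc) ?_⟩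
    rw [hop, hcs, mul_smul]
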